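/- Let $G=(V,E,\partial)$ be a countable, connected graph, where each edge $e\in E$ has a starting vertex $\partial_-e$ and an end vertex $\partial_+e$. Multiple edges are allowed, but there are no loops, i.e. $\partial_-e\neq\partial_+e$. Let $E_v$ be the set of edges with $v$ as an endpoint, $\deg v=|E_v|$, and assume that $2\le\deg v\le d_0$ for all $v\in V$ and some $d_0\in\mathbb N$. Let $\ell>0$. Let $\ell^2(V)$ be the Hilbert space of all $a:V\to\mathbb C$ with $\sum_v \deg v\,|a(v)|^2<\infty$, and let $\Delta_G$ be the bounded operator $$(\Delta_G a)(v)=-\frac1{\deg v}\sum_{e\in E_v}\bigl(a(v_e)-a(v)\bigr)$$ in $\ell^2(V)$, where $v_e$ is the endpoint of $e$ other than $v$. Let $X_0$ be the metric graph obtained by identifying every edge $e$ with the interval $(0,\ell)$, where $0$ corresponds to $\partial_-e$ and $\ell$ to $\partial_+e$. Let $L^2(X_0)=\bigoplus_{e}L^2(0,\ell)$, and let $H^1(X_0)$ be the space of all $f=(f_e)_e\in L^2(X_0)$ with $f_e\in H^1(0,\ell)$ and $f'=(f_e')_e\in L^2(X_0)$ that are continuous at the vertices. Let $\Delta_{X_0}$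 be the non-negative self-adjoint operator in $L^2(X_0)$ associated with the closed quadratic form $f\mapsto\sum_e\|f_e'\|^2$ with domain $H^1(X_0)$. For an operator $T$ let $\sigma_\emptyset(T)=\sigma(T)\subset\mathbb C$ be the spectrum, $\sigma_{\mathrm p}(T)$ the set of eigenvalues, $\sigma_{\mathrm c}(T)=\sigma(T)\setminus\sigma_{\mathrm p}(T)$, $\sigma_{\mathrm{pp}}(T)=\overline{\sigma_{\mathrm p}(T)}$, $\sigma_{\mathrm{disc}}(T)$ the set of eigenvalues of finite multiplicity that are isolated points of $\sigma(T)$, and $\sigma_{\mathrm{ess}}(T)=\sigma(T)\setminus\sigma_{\mathrm{disc}}(T)$. The multiplicity of $z$ is $\dim\ker(T-z)\in\{0,1,2,\dots,\infty\}$. Put $g(z)=1-\cos(\ell\sqrt z)$ for $z\in\mathbb C$ (this does not depend on the branch of the root) and $\Sigma^{\mathrm D}=\{(k\pi/\ell)^2: k=1,2,\dots\}$, so that $g^{-1}\{0,2\}=\Sigma^{\mathrm D}\cup\{0\}$. **Theorem.** For every $\bullet\in\{\mathrm p,\mathrm c,\emptyset,\mathrm{pp},\mathrm{disc},\mathrm{ess}\}$,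 $$\sigma_\bullet(\Delta_{X_0})\setminus(\Sigma^{\mathrm D}\cup\{0\})=g^{-1}\bigl(\sigma_\bullet(\Delta_G)\setminus\{0,2\}\bigr),$$ and for every $\lambda\in\mathbb C\setminus\Sigma^{\mathrm D}$, $$\lambda\in\sigma_\bullet(\Delta_{X_0})\iff g(\lambda)\in\sigma_\bullet(\Delta_G).$$ Furthermore, for every $\lambda\in\mathbb C\setminus\Sigma^{\mathrm D}$ the multiplicity of $\lambda$ for $\Delta_{X_0}$ equals the multiplicity of $g(\lambda)$ for $\Delta_G$. -/

import Mathlib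

open MeasureTheory Set Topology
open scoped ENNReal

noncomputable section

/-! ## Spectra of a densely or everywhere defined operator in a complex Hilbert space -/

namespace OperatorSpectrum

variable {H : Type*} [NormedAddCommGroup H] [InnerProductSpace ℂ H]

/-- The resolvent set of an operator `T` with domain `T.domain`: all `z` such that
`T - z` maps the domain bijectively onto `H` and has a bounded inverse `R`. -/
def resolventSet (T : H →ₗ.[ℂ] H) : Set ℂ :=
  {z | ∃ R : H →L[ℂ] H,
    (∀ w : H, ∃ h : R w ∈ T.domain, T ⟨R w, h⟩ - z • R w = w) ∧
    (∀ f : T.domain, R (T f - z • (f : H)) = f)}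

/-- The eigenspace `ker (T - z)`, i.e. all `f` in the domain with `T f = z f`. -/
def eigenspace (T : H →ₗ.[ℂ] H) (z : ℂ) : Submodule ℂ H :=
  T.graph.comap (LinearMap.id.prod (z • LinearMap.id))

theorem mem_eigenspace_iff (T : H →ₗ.[ℂ] H) (z : ℂ) (f : H) :
    f ∈ eigenspace T z ↔ ∃ h : f ∈ T.domain, T ⟨f, h⟩ = z • f := by
  simp [eigenspace, LinearPMap.mem_graph_iff]

/-- The multiplicity of `z` as an eigenvalue: the dimension of the eigenspace, with `⊤` for
infinite dimension and `0` if `z` is not an eigenvalue. -/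
def multiplicity (T : H →ₗ.[ℂ] H) (z : ℂ) : ℕ∞ :=
  Cardinal.toENat (Module.rank ℂ (eigenspace T z))

/-- The entire spectrum. -/
def fullSpectrum (T : H →ₗ.[ℂ] H) : Set ℂ := (resolventSet T)ᶜ

/-- The set of eigenvalues. -/
def pointSpectrum (T : H →ₗ.[ℂ] H) : Set ℂ := {z | eigenspace T z ≠ ⊥}

/-- The isolated points of the spectrum that are eigenvalues of finite multiplicity. -/
def discreteSpectrum (T : H →ₗ.[ℂ] H) : Set ℂ :=
  {z | z ∈ pointSpectrum T ∧ multiplicity T z ≠ ⊤ ∧ ∃ U ∈ 𝓝 z, fullSpectrum T ∩ U = {z}}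

/-- The labels of the six kinds of spectrum. -/
inductive SpectrumKind
  | point | continuous | full | purePoint | discrete | essential

/-- The spectrum of a given kind. Here the "continuous" spectrum is the complement of the set of
eigenvalues in the spectrum, and the pure point spectrum is the closure of the set of
eigenvalues. -/
def spectrumOf (k : SpectrumKind) (T : H →ₗ.[ℂ] H) : Set ℂ :=
  match k with
  | .point => pointSpectrum T
  | .continuous => fullSpectrum T \ pointSpectrum T
  | .full => fullSpectrum T
  | .purePoint => closure (pointSpectrum T)
  | .discrete => discreteSpectrum T
  | .essential => fullSpectrum T \ discreteSpectrum T

end OperatorSpectrum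

/-! ## Graphs -/

/-- A locally finite oriented graph with vertex set `V` and edge set `E`; each edge `e` starts
at `src e` and ends at `tgt e`. Loops and multiple edges are allowed. -/
structure OrientedGraph (V E : Type*) where
  src : E → V
  tgt : E → V
  finite_out : ∀ v, {e | src e = v}.Finite
  finite_in : ∀ v, {e | tgt e = v}.Finite

namespace OrientedGraph

variable {V E : Type*} (G : OrientedGraph V E)

/-- The edges starting at `v`. -/
def outEdges (v : V) : Finset E := (G.finite_out v).toFinset

/-- The edges ending at `v`. -/
def inEdges (v : V) : Finset E := (G.finite_in v).toFinset

/-- The degree of a vertex; a loop counts twice. -/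
def deg (v : V) : ℕ := (G.outEdges v).card + (G.inEdges v).card

/-- `G` is nonempty and any two vertices are joined by a path that ignores orientations. -/
def Connected : Prop := (SimpleGraph.fromRel fun v w => ∃ e, G.src e = v ∧ G.tgt e = w).Connected

/-! ### The discrete Laplacian -/

/-- The measure on the vertex set (all sets being measurable) that gives `v` the mass `deg v`. -/
def degMeasure : @Measure V ⊤ :=
  @Measure.sum V V ⊤ fun v => (G.deg v : ℝ≥0∞) • @Measure.dirac V ⊤ v

/-- The weighted space `ℓ²(V)`, with squared norm `∑ v, deg v * |a v| ^ 2`. -/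
abbrev VertexL2 : Type _ := Lp ℂ 2 G.degMeasure

/-- The expression `-(1 / deg v) ∑ (a w - a v)`, the sum running over all edges at `v`, where `w`
is the other end of the edge. -/
def lapFun (a : V → ℂ) (v : V) : ℂ :=
  -((G.deg v : ℂ)⁻¹ *
    (∑ e ∈ G.outEdges v, (a (G.tgt e) - a v) + ∑ e ∈ G.inEdges v, (a (G.src e) - a v)))

theorem lintegral_degMeasure (F : V → ℝ≥0∞) :
    ∫⁻ v, F v ∂G.degMeasure = ∑' v, G.deg v * F v := by
  let _ : MeasurableSpace V := ⊤
  simp only [degMeasure]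
  rw [lintegral_sum_measure]
  simp [lintegral_smul_measure]

theorem ae_degMeasure_iff (p : V → Prop) :
    (∀ᵐ v ∂G.degMeasure, p v) ↔ ∀ v, G.deg v ≠ 0 → p v := by
  let _ : MeasurableSpace V := ⊤
  simp only [degMeasure]
  rw [Measure.ae_sum_iff' (by trivial)]
  refine forall_congr' fun v => ?_
  by_cases h : G.deg v = 0
  · simp [h]
  · rw [Measure.ae_ennreal_smul_measure_eq (by exact_mod_cast h)]
    simp [ae_dirac_eq, h]

theorem memLp_degMeasure_iff (a : V → ℂ) :
    MemLp a 2 G.degMeasure ↔ ∑' v, (G.deg v : ℝ≥0∞) * ‖a v‖ₑ ^ 2 < ∞ := by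
  let _ : MeasurableSpace V := ⊤
  have hm : AEStronglyMeasurable a G.degMeasure :=
    (measurable_from_top : Measurable a).aestronglyMeasurable
  rw [MemLp, eLpNorm_lt_top_iff_lintegral_rpow_enorm_lt_top (by simp) (by simp)]
  simp only [hm, true_and]
  rw [← lintegral_degMeasure]
  simp

theorem tsum_sum_outEdges (F : E → ℝ≥0∞) : ∑' v, ∑ e ∈ G.outEdges v, F e = ∑' e, F e := by
  rw [← (Equiv.sigmaFiberEquiv G.src).tsum_eq, ENNReal.tsum_sigma']
  refine tsum_congr fun v => ?_
  rw [← Finset.tsum_subtype (G.outEdges v) F]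
  exact (Equiv.subtypeEquivRight (fun e => by simp [outEdges])).tsum_eq
    (fun e : {e // G.src e = v} => F e)

theorem tsum_sum_inEdges (F : E → ℝ≥0∞) : ∑' v, ∑ e ∈ G.inEdges v, F e = ∑' e, F e := by
  rw [← (Equiv.sigmaFiberEquiv G.tgt).tsum_eq, ENNReal.tsum_sigma']
  refine tsum_congr fun v => ?_
  rw [← Finset.tsum_subtype (G.inEdges v) F]
  exact (Equiv.subtypeEquivRight (fun e => by simp [inEdges])).tsum_eq
    (fun e : {e // G.tgt e = v} => F e)

theorem tsum_neighbours (F : V → ℝ≥0∞) :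
    ∑' v, (∑ e ∈ G.outEdges v, F (G.tgt e) + ∑ e ∈ G.inEdges v, F (G.src e))
      = ∑' v, G.deg v * F v := by
  rw [ENNReal.tsum_add, G.tsum_sum_outEdges, G.tsum_sum_inEdges,
    ← G.tsum_sum_outEdges (fun e => F (G.src e)),
    ← G.tsum_sum_inEdges (fun e => F (G.tgt e)), ← ENNReal.tsum_add]
  refine tsum_congr fun v => ?_
  have h1 : ∑ e ∈ G.inEdges v, F (G.tgt e) = (G.inEdges v).card * F v := by
    rw [Finset.sum_congr rfl (g := fun _ => F v) (fun e he => by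
      have : G.tgt e = v := by simpa [inEdges] using he
      rw [this])]
    simp
  have h2 : ∑ e ∈ G.outEdges v, F (G.src e) = (G.outEdges v).card * F v := by
    rw [Finset.sum_congr rfl (g := fun _ => F v) (fun e he => by
      have : G.src e = v := by simpa [outEdges] using he
      rw [this])]
    simp
  rw [h1, h2, deg]
  push_cast
  ring

theorem deg_mul_lapFun_le (a : V → ℂ) (v : V) :
    (G.deg v : ℝ) * ‖G.lapFun a v‖ ^ 2 ≤
      2 * (∑ e ∈ G.outEdges v, ‖a (G.tgt e)‖ ^ 2 + ∑ e ∈ G.inEdges v, ‖a (G.src e)‖ ^ 2)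
        + 2 * (G.deg v * ‖a v‖ ^ 2) := by
  rcases Nat.eq_zero_or_pos (G.deg v) with h0 | hpos
  · rw [h0]
    simp only [CharP.cast_eq_zero, zero_mul, mul_zero, add_zero]
    positivity
  have hd : (0 : ℝ) < G.deg v := by exact_mod_cast hpos
  set s := (G.outEdges v).disjSum (G.inEdges v) with hs
  let p : E ⊕ E → ℂ := Sum.elim (fun e => a (G.tgt e)) (fun e => a (G.src e))
  have hcard : (s.card : ℝ) = G.deg v := by
    rw [hs, Finset.card_disjSum, deg]
  have hsum : ∑ e ∈ G.outEdges v, (a (G.tgt e) - a v) + ∑ e ∈ G.inEdges v, (a (G.src e) - a v)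
      = ∑ x ∈ s, (p x - a v) := by
    rw [hs, Finset.sum_disjSum]
    rfl
  have hsum2 : ∑ e ∈ G.outEdges v, ‖a (G.tgt e)‖ ^ 2 + ∑ e ∈ G.inEdges v, ‖a (G.src e)‖ ^ 2
      = ∑ x ∈ s, ‖p x‖ ^ 2 := by
    rw [hs, Finset.sum_disjSum]
    rfl
  have h1 : ‖∑ x ∈ s, (p x - a v)‖ ^ 2 ≤ G.deg v * ∑ x ∈ s, ‖p x - a v‖ ^ 2 := by
    rw [← hcard]
    calc ‖∑ x ∈ s, (p x - a v)‖ ^ 2 ≤ (∑ x ∈ s, ‖p x - a v‖) ^ 2 := by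
          gcongr
          exact norm_sum_le _ _
      _ ≤ _ := sq_sum_le_card_mul_sum_sq
  have h2 : ∑ x ∈ s, ‖p x - a v‖ ^ 2 ≤ ∑ x ∈ s, (2 * ‖p x‖ ^ 2 + 2 * ‖a v‖ ^ 2) := by
    refine Finset.sum_le_sum fun x _ => ?_
    have h := norm_sub_le (p x) (a v)
    have h' : ‖p x - a v‖ ^ 2 ≤ (‖p x‖ + ‖a v‖) ^ 2 := by gcongr
    nlinarith [sq_nonneg (‖p x‖ - ‖a v‖)]
  have h3 : ∑ x ∈ s, (2 * ‖p x‖ ^ 2 + 2 * ‖a v‖ ^ 2)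
      = 2 * ∑ x ∈ s, ‖p x‖ ^ 2 + 2 * (G.deg v * ‖a v‖ ^ 2) := by
    rw [Finset.sum_add_distrib, ← Finset.mul_sum, Finset.sum_const, nsmul_eq_mul, hcard]
    ring
  rw [hsum2, ← h3]
  refine le_trans ?_ h2
  rw [lapFun, hsum, norm_neg, norm_mul, norm_inv, Complex.norm_natCast, mul_pow]
  calc (G.deg v : ℝ) * ((G.deg v : ℝ)⁻¹ ^ 2 * ‖∑ x ∈ s, (p x - a v)‖ ^ 2)
      = (G.deg v : ℝ)⁻¹ * ‖∑ x ∈ s, (p x - a v)‖ ^ 2 := by field_simp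
    _ ≤ (G.deg v : ℝ)⁻¹ * (G.deg v * ∑ x ∈ s, ‖p x - a v‖ ^ 2) := by gcongr
    _ = ∑ x ∈ s, ‖p x - a v‖ ^ 2 := by field_simp

theorem memLp_lapFun {a : V → ℂ} (ha : MemLp a 2 G.degMeasure) :
    MemLp (G.lapFun a) 2 G.degMeasure := by
  rw [memLp_degMeasure_iff] at ha ⊢
  have hsq : ∀ z : ℂ, ‖z‖ₑ ^ 2 = ENNReal.ofReal (‖z‖ ^ 2) := fun z => by
    rw [ENNReal.ofReal_pow (norm_nonneg z), ofReal_norm]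
  have key : ∀ v, (G.deg v : ℝ≥0∞) * ‖G.lapFun a v‖ₑ ^ 2 ≤
      2 * (∑ e ∈ G.outEdges v, ‖a (G.tgt e)‖ₑ ^ 2 + ∑ e ∈ G.inEdges v, ‖a (G.src e)‖ₑ ^ 2)
        + 2 * (G.deg v * ‖a v‖ₑ ^ 2) := fun v => by
    have h := ENNReal.ofReal_le_ofReal (G.deg_mul_lapFun_le a v)
    rw [ENNReal.ofReal_add (by positivity) (by positivity),
      ENNReal.ofReal_mul (by positivity), ENNReal.ofReal_mul (by positivity),
      ENNReal.ofReal_mul (by positivity), ENNReal.ofReal_mul (by positivity),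
      ENNReal.ofReal_add (by positivity) (by positivity),
      ENNReal.ofReal_sum_of_nonneg (fun _ _ => by positivity),
      ENNReal.ofReal_sum_of_nonneg (fun _ _ => by positivity)] at h
    simpa only [hsq, ENNReal.ofReal_natCast, ENNReal.ofReal_ofNat] using h
  refine lt_of_le_of_lt (ENNReal.tsum_le_tsum key) ?_
  rw [ENNReal.tsum_add, ENNReal.tsum_mul_left, ENNReal.tsum_mul_left,
    G.tsum_neighbours (fun v => ‖a v‖ₑ ^ 2)]
  exact ENNReal.add_lt_top.2
    ⟨ENNReal.mul_lt_top (by simp) ha, ENNReal.mul_lt_top (by simp) ha⟩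

theorem lapFun_congr_ae {a b : V → ℂ} (h : a =ᵐ[G.degMeasure] b) :
    G.lapFun a =ᵐ[G.degMeasure] G.lapFun b := by
  have h' := (G.ae_degMeasure_iff fun v => a v = b v).1 h
  refine (G.ae_degMeasure_iff fun v => G.lapFun a v = G.lapFun b v).2 fun v hv => ?_
  have h1 : ∀ e ∈ G.outEdges v, a (G.tgt e) = b (G.tgt e) := fun e _ => h' _ (by
    have : e ∈ G.inEdges (G.tgt e) := by simp [inEdges]
    have := Finset.card_pos.2 ⟨e, this⟩
    rw [deg]
    omega)
  have h2 : ∀ e ∈ G.inEdges v, a (G.src e) = b (G.src e) := fun e _ => h' _ (by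
    have : e ∈ G.outEdges (G.src e) := by simp [outEdges]
    have := Finset.card_pos.2 ⟨e, this⟩
    rw [deg]
    omega)
  rw [lapFun, lapFun, h' v hv, Finset.sum_congr rfl (fun e he => by rw [h1 e he]),
    Finset.sum_congr (s₁ := G.inEdges v) rfl (fun e he => by rw [h2 e he])]

/-- The discrete Laplacian `Δ_G`, an everywhere defined operator in `ℓ²(V)`. -/
def discreteLaplacian : G.VertexL2 →ₗ.[ℂ] G.VertexL2 :=
  LinearMap.toPMap
    { toFun := fun a => (G.memLp_lapFun (Lp.memLp a)).toLp (G.lapFun a)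
      map_add' := fun a b => by
        rw [← MemLp.toLp_add, MemLp.toLp_eq_toLp_iff]
        refine (G.lapFun_congr_ae (Lp.coeFn_add a b)).trans (Filter.Eventually.of_forall fun v => ?_)
        simp only [lapFun, Pi.add_apply, Finset.sum_sub_distrib, Finset.sum_add_distrib]
        ring
      map_smul' := fun c a => by
        rw [RingHom.id_apply, ← MemLp.toLp_const_smul, MemLp.toLp_eq_toLp_iff]
        refine (G.lapFun_congr_ae (Lp.coeFn_smul c a)).trans
          (Filter.Eventually.of_forall fun v => ?_)
        simp only [lapFun, Pi.smul_apply, smul_eq_mul, ← mul_sub, ← Finset.mul_sum]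
        ring }
    ⊤

/-! ### The equilateral metric graph and its Laplacian -/

/-- The space `L²(0, ℓ)`. -/
abbrev IntervalL2 (ℓ : ℝ) : Type := Lp ℂ 2 (volume.restrict (Ioo 0 ℓ))

/-- The Hilbert space `L²(X₀) = ⨁ₑ L²(0, ℓ)` of the metric graph with all edges of length `ℓ`. -/
abbrev EdgeL2 (E : Type*) (ℓ : ℝ) : Type _ := lp (fun _ : E => IntervalL2 ℓ) 2

/-- `f` belongs to the Sobolev space `H¹(X₀)`, with derivative `f'`: on each edge `e` the function
`f e` has an absolutely continuous representative `F e` on `[0, ℓ]` with derivative `f' e`, both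
`f` and `f'` are in `L²(X₀)`, and the `F e` fit together continuously at the vertices, where they
take the values `a v`. Here `0` corresponds to `src e` and `ℓ` to `tgt e`. -/
def HasSobolevDeriv (ℓ : ℝ) (f f' : EdgeL2 E ℓ) : Prop :=
  ∃ (F : E → ℝ → ℂ) (a : V → ℂ), ∀ e,
    f e =ᵐ[volume.restrict (Ioo 0 ℓ)] F e ∧
    (∀ x ∈ Icc 0 ℓ, F e x = F e 0 + ∫ t in (0 : ℝ)..x, f' e t) ∧
    F e 0 = a (G.src e) ∧ F e ℓ = a (G.tgt e)

theorem intervalIntegral_congr {ℓ x : ℝ} (hx : x ∈ Icc 0 ℓ) {g h : ℝ → ℂ}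
    (hgh : g =ᵐ[volume.restrict (Ioo 0 ℓ)] h) :
    ∫ t in (0 : ℝ)..x, g t = ∫ t in (0 : ℝ)..x, h t := by
  rw [intervalIntegral.integral_of_le hx.1, intervalIntegral.integral_of_le hx.1,
    integral_Ioc_eq_integral_Ioo, integral_Ioc_eq_integral_Ioo]
  exact integral_congr_ae (ae_restrict_of_ae_restrict_of_subset (Ioo_subset_Ioo_right hx.2) hgh)

theorem intervalIntegrable_of_intervalL2 {ℓ x : ℝ} (hx : x ∈ Icc 0 ℓ) (u : IntervalL2 ℓ) :
    IntervalIntegrable u volume 0 x := by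
  rw [intervalIntegrable_iff_integrableOn_Ioo_of_le hx.1]
  have h : IntegrableOn u (Ioo 0 ℓ) := (Lp.memLp u).integrable (by norm_num)
  exact h.mono_set (Ioo_subset_Ioo_right hx.2)

variable {G}

theorem HasSobolevDeriv.zero (ℓ : ℝ) : G.HasSobolevDeriv ℓ 0 0 := by
  refine ⟨fun _ _ => 0, fun _ => 0, fun e => ⟨Lp.coeFn_zero _ _ _, fun x hx => ?_, rfl, rfl⟩⟩
  have h : (fun t => ((0 : EdgeL2 E ℓ) e) t) =ᵐ[volume.restrict (Ioo 0 ℓ)] fun _ => (0 : ℂ) :=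
    Lp.coeFn_zero _ _ _
  rw [intervalIntegral_congr hx h]
  simp

theorem HasSobolevDeriv.add {ℓ : ℝ} {f f' g g' : EdgeL2 E ℓ} (hf : G.HasSobolevDeriv ℓ f f')
    (hg : G.HasSobolevDeriv ℓ g g') : G.HasSobolevDeriv ℓ (f + g) (f' + g') := by
  obtain ⟨F, a, hF⟩ := hf
  obtain ⟨K, b, hK⟩ := hg
  refine ⟨fun e x => F e x + K e x, fun v => a v + b v, fun e => ⟨?_, fun x hx => ?_, ?_, ?_⟩⟩
  · exact (Lp.coeFn_add (f e) (g e)).trans ((hF e).1.add (hK e).1)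
  · refine Eq.trans ?_ (congrArg (F e 0 + K e 0 + ·)
      (intervalIntegral_congr hx (Lp.coeFn_add (f' e) (g' e))).symm)
    simp only [Pi.add_apply]
    rw [intervalIntegral.integral_add (intervalIntegrable_of_intervalL2 hx _)
      (intervalIntegrable_of_intervalL2 hx _), (hF e).2.1 x hx, (hK e).2.1 x hx]
    ring
  · exact congrArg₂ (· + ·) (hF e).2.2.1 (hK e).2.2.1
  · exact congrArg₂ (· + ·) (hF e).2.2.2 (hK e).2.2.2

theorem HasSobolevDeriv.smul {ℓ : ℝ} {f f' : EdgeL2 E ℓ} (c : ℂ)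
    (hf : G.HasSobolevDeriv ℓ f f') : G.HasSobolevDeriv ℓ (c • f) (c • f') := by
  obtain ⟨F, a, hF⟩ := hf
  refine ⟨fun e x => c * F e x, fun v => c * a v, fun e => ⟨?_, fun x hx => ?_, ?_, ?_⟩⟩
  · exact (Lp.coeFn_smul c (f e)).trans ((hF e).1.const_smul c)
  · refine Eq.trans ?_ (congrArg (c * F e 0 + ·)
      (intervalIntegral_congr hx (Lp.coeFn_smul c (f' e))).symm)
    simp only [Pi.smul_apply, smul_eq_mul]
    rw [intervalIntegral.integral_const_mul, (hF e).2.1 x hx]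
    ring
  · exact congrArg (c * ·) (hF e).2.2.1
  · exact congrArg (c * ·) (hF e).2.2.2

variable (G)

/-- The graph of the operator associated with the quadratic form `f ↦ ‖f'‖²` with domain `H¹(X₀)`:
all pairs `(f, u)` with `f` in `H¹(X₀)`, `u` in `L²(X₀)` and `⟪g', f'⟫ = ⟪g, u⟫` for every `g` in
`H¹(X₀)`. -/
def laplacianGraph (ℓ : ℝ) : Submodule ℂ (EdgeL2 E ℓ × EdgeL2 E ℓ) where
  carrier := {p | ∃ f', G.HasSobolevDeriv ℓ p.1 f' ∧
    ∀ g g', G.HasSobolevDeriv ℓ g g' → inner ℂ g' f' = inner ℂ g p.2}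
  zero_mem' := ⟨0, .zero ℓ, fun g g' _ => by simp⟩
  add_mem' := by
    rintro p q ⟨f', hf, hp⟩ ⟨k', hk, hq⟩
    refine ⟨f' + k', hf.add hk, fun g g' hg => ?_⟩
    rw [inner_add_right, hp g g' hg, hq g g' hg, ← inner_add_right]
    rfl
  smul_mem' := by
    rintro c p ⟨f', hf, hp⟩
    refine ⟨c • f', hf.smul c, fun g g' hg => ?_⟩
    rw [inner_smul_right, hp g g' hg, ← inner_smul_right]
    rfl

/-- The (generalised Neumann, or Kirchhoff) Laplacian `Δ_{X₀}` on the metric graph: the operator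
associated with the quadratic form `f ↦ ‖f'‖²` on `H¹(X₀)`. -/
def metricLaplacian (ℓ : ℝ) : EdgeL2 E ℓ →ₗ.[ℂ] EdgeL2 E ℓ := (G.laplacianGraph ℓ).toLinearPMap

/-- A test function in the interior of a single edge belongs to `H¹(X₀)`. -/
theorem hasSobolevDeriv_single [DecidableEq E] {ℓ : ℝ} (e₀ : E) {φ : ℝ → ℝ}
    (hφ : ContDiff ℝ (⊤ : ℕ∞) φ) (hs : tsupport φ ⊆ Ioo 0 ℓ)
    (h0 : MemLp (fun x => (φ x : ℂ)) 2 (volume.restrict (Ioo 0 ℓ)))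
    (h1 : MemLp (fun x => ((deriv φ x : ℝ) : ℂ)) 2 (volume.restrict (Ioo 0 ℓ))) :
    G.HasSobolevDeriv ℓ (lp.single 2 e₀ (h0.toLp _)) (lp.single 2 e₀ (h1.toLp _)) := by
  have hz : ∀ x, x ∉ Ioo 0 ℓ → φ x = 0 := fun x hx => by
    by_contra h
    exact hx (hs (subset_tsupport φ h))
  refine ⟨fun e x => if e = e₀ then (φ x : ℂ) else 0, fun _ => 0, fun e => ?_⟩
  by_cases he : e = e₀
  · subst he
    simp only [lp.single_apply_self, if_true]
    refine ⟨h0.coeFn_toLp, fun x hx => ?_, by simp [hz 0 (by simp)], by simp [hz ℓ (by simp)]⟩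
    rw [intervalIntegral_congr hx h1.coeFn_toLp, intervalIntegral.integral_ofReal,
      intervalIntegral.integral_deriv_eq_sub
        (fun y _ => (hφ.differentiable (by simp)).differentiableAt)
        ((hφ.continuous_deriv (by simp)).intervalIntegrable _ _)]
    push_cast
    ring
  · simp only [lp.single_apply_ne _ _ _ he, if_neg he]
    refine ⟨Lp.coeFn_zero _ _ _, fun x hx => ?_, trivial, trivial⟩
    rw [intervalIntegral_congr hx (Lp.coeFn_zero _ _ _)]
    simp

theorem laplacianGraph_single_valued (ℓ : ℝ) {p : EdgeL2 E ℓ × EdgeL2 E ℓ}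
    (hp : p ∈ G.laplacianGraph ℓ) (h0 : p.1 = 0) : p.2 = 0 := by
  classical
  obtain ⟨f', hf, h⟩ := hp
  have hf' : f' = 0 := by
    have h1 := h p.1 f' hf
    rw [h0, inner_zero_left] at h1
    exact inner_self_eq_zero.1 h1
  have huz : ∀ e₀, p.2 e₀ = 0 := fun e₀ => by
    have hu : IntegrableOn (p.2 e₀) (Ioo 0 ℓ) := (Lp.memLp (p.2 e₀)).integrable (by norm_num)
    have key := isOpen_Ioo.ae_eq_zero_of_integral_contDiff_smul_eq_zero hu.locallyIntegrableOn
      (fun φ hφ hc hs => by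
        have m0 : MemLp (fun x => (φ x : ℂ)) 2 (volume.restrict (Ioo 0 ℓ)) :=
          ((Complex.continuous_ofReal.comp hφ.continuous).memLp_of_hasCompactSupport
            (hc.comp_left Complex.ofReal_zero)).restrict _
        have m1 : MemLp (fun x => ((deriv φ x : ℝ) : ℂ)) 2 (volume.restrict (Ioo 0 ℓ)) :=
          ((Complex.continuous_ofReal.comp (hφ.continuous_deriv
            (by simp))).memLp_of_hasCompactSupport
            (hc.deriv.comp_left Complex.ofReal_zero)).restrict _
        have hin := h _ _ (G.hasSobolevDeriv_single e₀ hφ hs m0 m1)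
        rw [hf', inner_zero_right, lp.inner_single_left, L2.inner_def] at hin
        have hz : ∀ x, x ∉ Ioo 0 ℓ → φ x • (p.2 e₀ x : ℂ) = 0 := fun x hx => by
          have : φ x = 0 := by
            by_contra hne
            exact hx (hs (subset_tsupport φ hne))
          rw [this, zero_smul]
        rw [← setIntegral_eq_integral_of_forall_compl_eq_zero hz]
        refine Eq.trans (integral_congr_ae ?_) hin.symm
        filter_upwards [m0.coeFn_toLp] with x hx
        rw [hx]
        simp [mul_comm])
    rw [Lp.eq_zero_iff_ae_eq_zero]
    exact (ae_restrict_iff' measurableSet_Ioo).2 key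
  exact lp.ext (funext huz)

/-- The graph of `Δ_{X₀}` is indeed the set of pairs that defines it. -/
theorem metricLaplacian_graph (ℓ : ℝ) : (G.metricLaplacian ℓ).graph = G.laplacianGraph ℓ :=
  Submodule.toLinearPMap_graph_eq _ fun _ hx h0 => G.laplacianGraph_single_valued ℓ hx h0

end OrientedGraph

/-! ## The relation between the two spectral parameters -/

/-- The Dirichlet spectrum `(k π / ℓ)²`, `k = 1, 2, …`, of an edge. -/
def dirichletSpectrum (ℓ : ℝ) : Set ℂ :=
  {z | ∃ k : ℕ, 1 ≤ k ∧ z = (((k * Real.pi / ℓ) ^ 2 : ℝ) : ℂ)}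

/-- The function `g(z) = 1 - cos (ℓ √z)`; it does not depend on the branch of the square root. -/
def spectralMap (ℓ : ℝ) (z : ℂ) : ℂ := 1 - Complex.cos (ℓ * z ^ (1 / 2 : ℂ))

end

/-! Write `c = cosSol z ℓ` and `s = sinSol z ℓ`. Off the Dirichlet spectrum `s ≠ 0`, so on each edge
`-f'' - z f = w` has a unique solution with prescribed end values. A solution `f` on the metric
graph is thus `P (a, w)`, with `a` its vertex values, and what remains of `(Δ_{X₀} - z) f = w` is
that the slopes pointing into the edges sum to zero at every vertex. Such a slope is (value at the
other end - `c` times own value + source term) / `s`, so this condition is `(Δ_G - g(z)) a = B w`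
with `g(z) = 1 - c` and `B w` the vertex average of the source terms (`vertexFlux_eq`,
`IsSolutionPair.mem_laplacianGraph_iff`).

Since `P (·, 0)` is injective and `B` is surjective, this equivalence gives isomorphic eigenspaces
(`multiplicity_eq_of_solution`) and equivalent bounded invertibility
(`mem_resolventSet_iff_of_solution`).

Closures and isolated points require more than a pointwise relation. Since `g'(z) = ℓ s / 2 ≠ 0`,
`g` is a local homeomorphism off the Dirichlet spectrum (`spectralMap_locally_bijective`), and
`mem_spectrumOf_iff_of_local` carries over all kinds of spectrum. -/

noncomputable section

/-! ### Transfer of spectra between two abstract operators -/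

namespace OperatorSpectrum

theorem mem_resolventSet_iff {H : Type*} [NormedAddCommGroup H] [InnerProductSpace ℂ H]
    (T : H →ₗ.[ℂ] H) (z : ℂ) :
    z ∈ resolventSet T ↔
      ∃ R : H →L[ℂ] H, ∀ f w : H, (f, w + z • f) ∈ T.graph ↔ f = R w := by
  constructor
  · rintro ⟨R, h1, h2⟩
    refine ⟨R, fun f w => ⟨fun h => ?_, ?_⟩⟩
    · obtain ⟨hd, he⟩ := T.mem_graph_iff.1 h
      have h3 := h2 hd
      simp only at he
      rw [he.2, he.1, add_sub_cancel_right] at h3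
      exact h3.symm
    · rintro rfl
      obtain ⟨hd, he⟩ := h1 w
      exact T.mem_graph_iff.2 ⟨⟨R w, hd⟩, rfl, by simp [← sub_eq_iff_eq_add, he]⟩
  · rintro ⟨R, hR⟩
    refine ⟨R, fun w => ?_, fun f => ?_⟩
    · obtain ⟨hd, he⟩ := T.mem_graph_iff.1 ((hR (R w) w).2 rfl)
      simp only at he
      have hm : R w ∈ T.domain := he.1 ▸ hd.2
      refine ⟨hm, ?_⟩
      have : (⟨R w, hm⟩ : T.domain) = hd := Subtype.ext he.1.symm
      rw [this, he.2, add_sub_cancel_right]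
    · refine ((hR f (T f - z • (f : H))).1 ?_).symm
      rw [sub_add_cancel]
      exact T.mem_graph f

section Transfer

variable {H K : Type*} [NormedAddCommGroup H] [InnerProductSpace ℂ H]
  [NormedAddCommGroup K] [InnerProductSpace ℂ K]
  {T : H →ₗ.[ℂ] H} {S : K →ₗ[ℂ] K} {z μ : ℂ} {P : K × H →L[ℂ] H} {B : H →L[ℂ] K}

theorem mem_graph_toPMap_top {a b : K} : (a, b) ∈ (S.toPMap ⊤).graph ↔ S a = b := by
  rw [LinearPMap.mem_graph_iff]
  constructor
  · rintro ⟨y, rfl, h⟩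
    exact h
  · intro h
    exact ⟨⟨a, trivial⟩, rfl, h⟩

theorem mem_eigenspace_iff_graph {f : H} : f ∈ eigenspace T z ↔ (f, z • f) ∈ T.graph := Iff.rfl

/-- For `w = 0` the equation reduces to `(S - μ) a = 0`, so `P (·, 0)` maps one eigenspace
isomorphically onto the other. -/
theorem multiplicity_eq_of_solution
    (hP : ∀ a, P (a, 0) = 0 → a = 0)
    (hchar : ∀ f w, (f, w + z • f) ∈ T.graph ↔ ∃ a, P (a, w) = f ∧ S a - μ • a = B w) :
    multiplicity T z = multiplicity (S.toPMap ⊤) μ := by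
  let Γ : K →ₗ[ℂ] H := P.toLinearMap ∘ₗ LinearMap.inl ℂ K H
  have hΓ : Function.Injective Γ := (injective_iff_map_eq_zero Γ).2 hP
  have hmap : eigenspace T z = (eigenspace (S.toPMap ⊤) μ).map Γ := by
    ext f
    have h := hchar f 0
    rw [zero_add] at h
    rw [mem_eigenspace_iff_graph, h, Submodule.mem_map]
    refine exists_congr fun a => ?_
    rw [mem_eigenspace_iff_graph, mem_graph_toPMap_top, map_zero, sub_eq_zero, and_comm]
    rfl
  have e := Submodule.equivMapOfInjective Γ hΓ (eigenspace (S.toPMap ⊤) μ)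
  rw [← hmap] at e
  have h := congrArg Cardinal.toENat e.lift_rank_eq
  rw [Cardinal.toENat_lift, Cardinal.toENat_lift] at h
  exact h.symm

/-- Formally the resolvent of `T` at `z` is `w ↦ P ((S - μ)⁻¹ B w, w)`. Conversely, surjectivity of
`B` makes every right-hand side in `K` accessible, and injectivity of `P (·, 0)` recovers `a` from
`f`. -/
theorem mem_resolventSet_iff_of_solution [CompleteSpace H] [CompleteSpace K]
    (hB : Function.Surjective B) (hP : ∀ a, P (a, 0) = 0 → a = 0)
    (hchar : ∀ f w, (f, w + z • f) ∈ T.graph ↔ ∃ a, P (a, w) = f ∧ S a - μ • a = B w) :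
    z ∈ resolventSet T ↔ μ ∈ resolventSet (S.toPMap ⊤) := by
  have hP' : ∀ {a b w}, P (a, w) = P (b, w) → a = b := fun {a b w} h => by
    rw [← sub_eq_zero]
    refine hP _ ?_
    have : ((a - b, 0) : K × H) = (a, w) - (b, w) := by simp
    rw [this, map_sub, h, sub_self]
  rw [mem_resolventSet_iff, mem_resolventSet_iff]
  simp only [mem_graph_toPMap_top, ← sub_eq_iff_eq_add]
  constructor
  · rintro ⟨R, hR⟩
    let L : K →ₗ[ℂ] K := S - μ • LinearMap.id
    have hL : Function.Bijective L := by
      refine ⟨(injective_iff_map_eq_zero L).2 fun a ha => ?_, fun k => ?_⟩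
      · have h := (hR _ _).1 ((hchar (P (a, 0)) 0).2 ⟨a, rfl, by rw [map_zero]; exact ha⟩)
        exact hP a (by rw [h, map_zero])
      · obtain ⟨w, rfl⟩ := hB k
        obtain ⟨a, -, ha⟩ := (hchar _ _).1 ((hR (R w) w).2 rfl)
        exact ⟨a, ha⟩
    let N : K →ₗ[ℂ] K := (LinearEquiv.ofBijective L hL).symm
    have hLN : ∀ k, L (N k) = k := (LinearEquiv.ofBijective L hL).apply_symm_apply
    have hNL : ∀ a, N (L a) = a := (LinearEquiv.ofBijective L hL).symm_apply_apply
    have hNB : ∀ w, P (N (B w), w) = R w := fun w =>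
      (hR _ _).1 ((hchar _ _).2 ⟨N (B w), rfl, hLN (B w)⟩)
    -- Closed graph theorem: a limit `y` of `N (B (u n))` satisfies `P (y, x) = R x = P (N (B x),
    -- x)`, which determines `y`.
    have hc : Continuous (N ∘ₗ B.toLinearMap) := by
      refine LinearMap.continuous_of_seq_closed_graph _ fun u x y hu hy => ?_
      have h1 : Filter.Tendsto (fun n => P (N (B (u n)), u n)) Filter.atTop (𝓝 (P (y, x))) :=
        (P.continuous.tendsto _).comp (hy.prodMk_nhds hu)
      simp only [hNB] at h1
      have h2 := tendsto_nhds_unique h1 ((R.continuous.tendsto x).comp hu)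
      rw [← hNB] at h2
      exact hP' h2
    -- By the open mapping theorem `B` is a quotient map, so continuity descends from `N ∘ B` to
    -- `N`.
    have hN : Continuous N := (B.isQuotientMap hB).continuous_iff.2 hc
    refine ⟨⟨N, hN⟩, fun a k => ?_⟩
    change L a = k ↔ a = N k
    constructor
    · rintro rfl
      exact (hNL a).symm
    · rintro rfl
      exact hLN k
  · rintro ⟨R, hR⟩
    refine ⟨P ∘L ((R ∘L B).prod (ContinuousLinearMap.id ℂ H)), fun f w => ?_⟩
    rw [hchar]
    simp only [hR]
    constructor
    · rintro ⟨a, rfl, rfl⟩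
      rfl
    · rintro rfl
      exact ⟨_, rfl, rfl⟩

end Transfer

/-- If a map is locally bijective at every point of a set of spectral parameters, and on this set
it relates the eigenvalues, their multiplicities and the resolvent sets of two operators, then it
relates all kinds of spectra. -/
theorem mem_spectrumOf_iff_of_local {H K : Type*} [NormedAddCommGroup H] [InnerProductSpace ℂ H]
    [NormedAddCommGroup K] [InnerProductSpace ℂ K] {T : H →ₗ.[ℂ] H} {S : K →ₗ.[ℂ] K}
    {g : ℂ → ℂ} {z : ℂ} (hz : Filter.map g (𝓝 z) = 𝓝 (g z))
    (hinj : ∀ᶠ y in 𝓝 z, g y = g z → y = z)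
    (hres : ∀ᶠ y in 𝓝 z, y ∈ resolventSet T ↔ g y ∈ resolventSet S)
    (hmul : ∀ᶠ y in 𝓝 z, multiplicity T y = multiplicity S (g y)) (k : SpectrumKind) :
    z ∈ spectrumOf k T ↔ g z ∈ spectrumOf k S := by
  have hpt : ∀ {y}, multiplicity T y = multiplicity S (g y) →
      (y ∈ pointSpectrum T ↔ g y ∈ pointSpectrum S) := fun {y} h => by
    have h0 : multiplicity T y = 0 ↔ multiplicity S (g y) = 0 := by rw [h]
    simp only [multiplicity, Cardinal.toENat_eq_zero, Submodule.rank_eq_zero] at h0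
    exact not_congr h0
  have hfull : ∀ᶠ y in 𝓝 z, y ∈ fullSpectrum T ↔ g y ∈ fullSpectrum S :=
    hres.mono fun y hy => not_congr hy
  -- Isolation as an eventual property can be pulled back along `map g (𝓝 z) = 𝓝 (g z)`.
  have hisol : ∀ {s : Set ℂ} {x : ℂ}, (∃ U ∈ 𝓝 x, s ∩ U = {x}) ↔
      x ∈ s ∧ ∀ᶠ y in 𝓝 x, y ∈ s → y = x := fun {s x} => by
    constructor
    · rintro ⟨U, hU, h⟩
      have hx : x ∈ s ∩ U := h ▸ rfl
      refine ⟨hx.1, Filter.mem_of_superset hU fun y hy hys => ?_⟩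
      have : y ∈ s ∩ U := ⟨hys, hy⟩
      rwa [h] at this
    · rintro ⟨hx, h⟩
      refine ⟨_, h, Set.eq_singleton_iff_unique_mem.2 ⟨⟨hx, fun _ => rfl⟩, fun y hy => hy.2 hy.1⟩⟩
  have hdisc : z ∈ discreteSpectrum T ↔ g z ∈ discreteSpectrum S := by
    simp only [discreteSpectrum, Set.mem_ofPred_eq]
    rw [hpt hmul.self_of_nhds, hmul.self_of_nhds, hisol, hisol, hfull.self_of_nhds, ← hz,
      Filter.eventually_map]
    refine and_congr_right fun _ => and_congr_right fun _ => and_congr_right fun _ => ?_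
    refine Filter.eventually_congr ?_
    filter_upwards [hfull, hinj] with y h1 h2
    rw [h1]
    -- Local injectivity is needed here: an isolated `g z` must not have preimages accumulating at
    -- `z`.
    exact imp_congr_right fun _ => ⟨fun h => h ▸ rfl, h2⟩
  cases k with
  | point => exact hpt hmul.self_of_nhds
  | continuous => exact and_congr hfull.self_of_nhds (not_congr (hpt hmul.self_of_nhds))
  | full => exact hfull.self_of_nhds
  | purePoint =>
    simp only [spectrumOf]
    rw [mem_closure_iff_frequently, mem_closure_iff_frequently, ← hz, Filter.frequently_map]
    exact Filter.frequently_congr (hmul.mono fun y hy => hpt hy)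
  | discrete => exact hdisc
  | essential => exact and_congr hfull.self_of_nhds (not_congr hdisc)

end OperatorSpectrum

/-! ### Fundamental solutions of `-f'' = z f` -/

/-- The solution of `-f'' = z f` with `f 0 = 1` and `f' 0 = 0`. -/
def cosSol (z : ℂ) (x : ℝ) : ℂ := Complex.cos (z ^ (1 / 2 : ℂ) * x)

/-- The solution of `-f'' = z f` with `f 0 = 0` and `f' 0 = 1`. -/
def sinSol (z : ℂ) (x : ℝ) : ℂ :=
  if z = 0 then x else Complex.sin (z ^ (1 / 2 : ℂ) * x) / z ^ (1 / 2 : ℂ)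

theorem cpow_half_sq (z : ℂ) : (z ^ (1 / 2 : ℂ)) ^ 2 = z := by
  rw [← Complex.cpow_nat_mul]
  norm_num

theorem cpow_half_ne_zero {z : ℂ} (hz : z ≠ 0) : z ^ (1 / 2 : ℂ) ≠ 0 := fun h =>
  hz (by rw [← cpow_half_sq z, h]; simp)

@[simp] theorem cosSol_zero (z : ℂ) : cosSol z 0 = 1 := by simp [cosSol]

@[simp] theorem sinSol_zero (z : ℂ) : sinSol z 0 = 0 := by simp [sinSol]

theorem hasDerivAt_cosSol (z : ℂ) (x : ℝ) :
    HasDerivAt (cosSol z) (-z * sinSol z x) x := by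
  have h := (((hasDerivAt_id (x : ℂ)).const_mul (z ^ (1 / 2 : ℂ))).ccos).comp_ofReal
  refine h.congr_deriv ?_
  by_cases hz : z = 0
  · simp [sinSol, hz]
  · have h0 := cpow_half_ne_zero hz
    rw [sinSol, if_neg hz]
    nth_rw 4 [← cpow_half_sq z]
    field_simp
    simp

theorem hasDerivAt_sinSol (z : ℂ) (x : ℝ) : HasDerivAt (sinSol z) (cosSol z x) x := by
  by_cases hz : z = 0
  · have h := (hasDerivAt_id (x : ℂ)).comp_ofReal
    refine (h.congr_deriv (by simp [cosSol, hz])).congr_of_eventuallyEq ?_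
    exact Filter.Eventually.of_forall fun y => by simp [sinSol, hz]
  · have h := ((((hasDerivAt_id (x : ℂ)).const_mul (z ^ (1 / 2 : ℂ))).csin).div_const
      (z ^ (1 / 2 : ℂ))).comp_ofReal
    have h0 := cpow_half_ne_zero hz
    refine (h.congr_deriv (by simp [cosSol]; field_simp)).congr_of_eventuallyEq ?_
    exact Filter.Eventually.of_forall fun y => by simp [sinSol, hz]

theorem continuous_cosSol (z : ℂ) : Continuous (cosSol z) :=
  continuous_iff_continuousAt.2 fun x => (hasDerivAt_cosSol z x).continuousAt

theorem continuous_sinSol (z : ℂ) : Continuous (sinSol z) :=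
  continuous_iff_continuousAt.2 fun x => (hasDerivAt_sinSol z x).continuousAt

/-- The left side is the Wronskian of the two fundamental solutions; its being 1 makes variation of
constants work. -/
theorem cosSol_sq_add (z : ℂ) (x : ℝ) : cosSol z x ^ 2 + z * sinSol z x ^ 2 = 1 := by
  by_cases hz : z = 0
  · simp [cosSol, hz]
  · have h0 := cpow_half_ne_zero hz
    rw [sinSol, if_neg hz, cosSol]
    nth_rw 2 [← cpow_half_sq z]
    field_simp
    exact Complex.cos_sq_add_sin_sq _

theorem spectralMap_eq (ℓ : ℝ) (z : ℂ) : spectralMap ℓ z = 1 - cosSol z ℓ := by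
  rw [spectralMap, cosSol, mul_comm]

/-- A zero would force `ℓ √z = k π`. The point `z = 0` causes no trouble, as `sinSol 0 ℓ = ℓ`. -/
theorem sinSol_ne_zero {ℓ : ℝ} (hℓ : 0 < ℓ) {z : ℂ} (hz : z ∉ dirichletSpectrum ℓ) :
    sinSol z ℓ ≠ 0 := by
  have hℓ' : (ℓ : ℂ) ≠ 0 := by exact_mod_cast hℓ.ne'
  rw [sinSol]
  split_ifs with h
  · exact hℓ'
  · have h0 := cpow_half_ne_zero h
    refine div_ne_zero (fun hs => hz ?_) h0
    obtain ⟨k, hk⟩ := Complex.sin_eq_zero_iff.1 hs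
    have hr : z ^ (1 / 2 : ℂ) = k * Real.pi / ℓ := by
      rw [eq_div_iff hℓ', hk]
    have hzk : z = (k * Real.pi / ℓ) ^ 2 := by rw [← hr, cpow_half_sq]
    -- The integer `k` may be negative, but only its square matters; `k = 0` would give `z = 0`.
    refine ⟨k.natAbs, Nat.one_le_iff_ne_zero.2 fun hk0 => h ?_, ?_⟩
    · rw [hzk, Int.natAbs_eq_zero.1 hk0]
      simp
    · have h2 : ((k.natAbs : ℝ)) ^ 2 = (k : ℝ) ^ 2 := by
        rw [Nat.cast_natAbs, Int.cast_abs, sq_abs]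
      rw [hzk, div_pow, mul_pow, div_pow, mul_pow, h2]
      push_cast
      rfl

/-- With `g = 1 - c`, the Wronskian identity reads `g (2 - g) = z s²`. -/
theorem spectralMap_mem_iff {ℓ : ℝ} (hℓ : 0 < ℓ) (z : ℂ) :
    spectralMap ℓ z ∈ ({0, 2} : Set ℂ) ↔ z ∈ insert 0 (dirichletSpectrum ℓ) := by
  have hℓ' : (ℓ : ℂ) ≠ 0 := by exact_mod_cast hℓ.ne'
  have hsq := cosSol_sq_add z ℓ
  have h1 : spectralMap ℓ z ∈ ({0, 2} : Set ℂ) ↔ z * sinSol z ℓ ^ 2 = 0 := by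
    rw [spectralMap_eq, mem_insert_iff, mem_singleton_iff]
    constructor
    · rintro (h | h)
      · linear_combination hsq - (-1 - cosSol z ℓ) * h
      · linear_combination hsq - (1 - cosSol z ℓ) * h
    · intro h
      have : (1 - cosSol z ℓ) * (1 - cosSol z ℓ - 2) = 0 := by linear_combination hsq - h
      rcases mul_eq_zero.1 this with h | h
      · exact Or.inl h
      · exact Or.inr (by linear_combination h)
  rw [h1, mem_insert_iff, mul_eq_zero, pow_eq_zero_iff two_ne_zero]
  refine or_congr_right' fun hz => ⟨fun h => ?_, ?_⟩
  · by_contra hd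
    exact sinSol_ne_zero hℓ hd h
  · rintro ⟨k, -, hk⟩
    rw [sinSol, if_neg hz, div_eq_zero_iff]
    refine Or.inl ?_
    have : (z ^ (1 / 2 : ℂ)) ^ 2 = (k * Real.pi / ℓ) ^ 2 := by
      rw [cpow_half_sq, hk]
      push_cast
      rfl
    rcases sq_eq_sq_iff_eq_or_eq_neg.1 this with h | h
    · rw [h, div_mul_cancel₀ _ hℓ']
      exact Complex.sin_nat_mul_pi k
    · rw [h, neg_mul, div_mul_cancel₀ _ hℓ', Complex.sin_neg, Complex.sin_nat_mul_pi, neg_zero]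

/-- The Dirichlet spectrum is real. The duality argument in `eq_zero_of_weak_solution` solves the
equation with the conjugate parameter. -/
theorem conj_notMem_dirichletSpectrum {ℓ : ℝ} {z : ℂ} (hz : z ∉ dirichletSpectrum ℓ) :
    starRingEnd ℂ z ∉ dirichletSpectrum ℓ := by
  rintro ⟨k, hk, h⟩
  refine hz ⟨k, hk, ?_⟩
  rw [← Complex.conj_conj z, h, Complex.conj_ofReal]

/-! ### Holomorphy and local invertibility of the spectral map -/

/-- The cosine is even and `sin (ℓ r) / r` is even in `r`, so any square root that is differentiable
at `z` may replace the principal one. -/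
theorem hasDerivAt_spectralMap_of_sqrt (ℓ : ℝ) {z r' : ℂ} {r : ℂ → ℂ} (hz : z ≠ 0)
    (hr : ∀ y, r y ^ 2 = y) (hd : HasDerivAt r r' z) :
    HasDerivAt (spectralMap ℓ) (ℓ * sinSol z ℓ / 2) z := by
  have hcos : spectralMap ℓ = fun y => 1 - Complex.cos (ℓ * r y) := funext fun y => by
    rw [spectralMap]
    have : (y ^ (1 / 2 : ℂ)) ^ 2 = r y ^ 2 := by rw [cpow_half_sq, hr]
    rcases sq_eq_sq_iff_eq_or_eq_neg.1 this with h | h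
    · rw [h]
    · rw [h, mul_neg, Complex.cos_neg]
  have hr0 : r z ≠ 0 := fun h => hz (by rw [← hr z, h]; simp)
  have hr' : 2 * r z * r' = 1 := by
    have h1 := hd.pow 2
    have h2 : HasDerivAt (r ^ 2) 1 z := (funext hr : r ^ 2 = id) ▸ hasDerivAt_id z
    simpa using h1.unique h2
  have hs : sinSol z ℓ = Complex.sin (ℓ * r z) / r z := by
    rw [sinSol, if_neg hz]
    have : (z ^ (1 / 2 : ℂ)) ^ 2 = r z ^ 2 := by rw [cpow_half_sq, hr]
    rcases sq_eq_sq_iff_eq_or_eq_neg.1 this with h | h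
    · rw [h, mul_comm]
    · rw [h, neg_mul, Complex.sin_neg, neg_div_neg_eq, mul_comm]
  rw [hcos, hs]
  refine ((hd.const_mul (ℓ : ℂ)).ccos.const_sub 1).congr_deriv ?_
  field_simp
  linear_combination (Complex.sin (ℓ * r z) * ℓ) * hr'

/-- No branch of the root is differentiable at 0. Instead, `1 - cos (ℓ r) = 2 sin² (ℓ r / 2)` with
`r² = y` makes the difference quotient `2 (sin (ℓ r / 2) / r)²`, which tends to `2 (ℓ / 2)²`. -/
theorem hasDerivAt_spectralMap_zero (ℓ : ℝ) :
    HasDerivAt (spectralMap ℓ) (ℓ * sinSol 0 ℓ / 2) 0 := by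
  have hsqrt : Filter.Tendsto (fun y : ℂ => y ^ (1 / 2 : ℂ)) (𝓝 0) (𝓝 0) := by
    have h := (Complex.continuousAt_cpow_const_of_re_pos (z := 0) (w := 1 / 2) (by simp)
      (by norm_num)).tendsto
    simpa using h
  have hslope : HasDerivAt (fun w : ℂ => Complex.sin (ℓ / 2 * w)) (ℓ / 2) 0 := by
    simpa using ((hasDerivAt_id (0 : ℂ)).const_mul (ℓ / 2 : ℂ)).csin
  have hs : spectralMap ℓ = fun y => 2 * Complex.sin (ℓ / 2 * y ^ (1 / 2 : ℂ)) ^ 2 :=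
    funext fun y => by
      have h := Complex.cos_sq' (ℓ / 2 * y ^ (1 / 2 : ℂ))
      have h2 := Complex.cos_two_mul (ℓ / 2 * y ^ (1 / 2 : ℂ))
      rw [spectralMap, show (ℓ : ℂ) * y ^ (1 / 2 : ℂ) = 2 * (ℓ / 2 * y ^ (1 / 2 : ℂ)) by ring, h2, h]
      ring
  rw [hasDerivAt_iff_tendsto_slope]
  have ht := (hasDerivAt_iff_tendsto_slope.1 hslope).comp
    (tendsto_nhdsWithin_of_tendsto_nhds_of_eventually_within _
      (hsqrt.mono_left nhdsWithin_le_nhds)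
      (eventually_mem_nhdsWithin.mono fun y hy => cpow_half_ne_zero hy))
  have ht2 := (ht.pow 2).const_mul 2
  have hval : (2 : ℂ) * (ℓ / 2) ^ 2 = ℓ * sinSol 0 ℓ / 2 := by
    simp only [sinSol, if_true]
    ring
  rw [hval] at ht2
  refine ht2.congr' (eventually_mem_nhdsWithin.mono fun y hy => ?_)
  have hy0 : y ≠ 0 := hy
  have h0 := cpow_half_ne_zero hy0
  simp only [slope_def_field, Function.comp_apply, hs]
  rw [show (0 : ℂ) ^ (1 / 2 : ℂ) = 0 by simp]
  simp only [mul_zero, Complex.sin_zero, sub_zero, div_pow, cpow_half_sq]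
  ring

theorem hasDerivAt_spectralMap (ℓ : ℝ) (z : ℂ) :
    HasDerivAt (spectralMap ℓ) (ℓ * sinSol z ℓ / 2) z := by
  by_cases hz : z = 0
  · rw [hz]
    exact hasDerivAt_spectralMap_zero ℓ
  by_cases hs : z ∈ Complex.slitPlane
  · exact hasDerivAt_spectralMap_of_sqrt ℓ hz cpow_half_sq
      ((hasDerivAt_id z).cpow_const hs)
  · have hs' : -z ∈ Complex.slitPlane := by
      simp only [Complex.mem_slitPlane_iff, not_or, not_lt, not_not, Complex.neg_re,
        Complex.neg_im] at hs ⊢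
      refine Or.inl (neg_pos.2 (lt_of_le_of_ne hs.1 fun h => hz (Complex.ext h hs.2)))
    -- On the negative axis, the cut of the principal root, this branch is holomorphic.
    refine hasDerivAt_spectralMap_of_sqrt ℓ hz (r := fun y => Complex.I * (-y) ^ (1 / 2 : ℂ))
      (fun y => ?_) (((hasDerivAt_id z).neg.cpow_const hs').const_mul _)
    rw [mul_pow, cpow_half_sq, Complex.I_sq]
    ring

theorem hasStrictDerivAt_spectralMap (ℓ : ℝ) (z : ℂ) :
    HasStrictDerivAt (spectralMap ℓ) (ℓ * sinSol z ℓ / 2) z := by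
  have hd : Differentiable ℂ (spectralMap ℓ) := fun y =>
    (hasDerivAt_spectralMap ℓ y).differentiableAt
  have h := (hd.contDiff (n := 1)).contDiffAt (x := z) |>.hasStrictDerivAt (by norm_num)
  rwa [(hasDerivAt_spectralMap ℓ z).deriv] at h

theorem spectralMap_locally_bijective {ℓ : ℝ} (hℓ : 0 < ℓ) {z : ℂ}
    (hz : z ∉ dirichletSpectrum ℓ) :
    Filter.map (spectralMap ℓ) (𝓝 z) = 𝓝 (spectralMap ℓ z) ∧
      ∀ᶠ y in 𝓝 z, spectralMap ℓ y = spectralMap ℓ z → y = z := by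
  have hℓ' : (ℓ : ℂ) ≠ 0 := by exact_mod_cast hℓ.ne'
  have h := hasStrictDerivAt_spectralMap ℓ z
  have h0 : ℓ * sinSol z ℓ / 2 ≠ 0 :=
    div_ne_zero (mul_ne_zero hℓ' (sinSol_ne_zero hℓ hz)) two_ne_zero
  refine ⟨h.map_nhds_eq h0, ?_⟩
  have hl := h.eventually_left_inverse h0
  filter_upwards [hl] with y hy he
  rw [← hy, he, hl.self_of_nhds]

/-- A Dirichlet point `y` has its image in the finite set `{0, 2}`. Near `z`, continuity excludes
the values other than `g z`, and local injectivity excludes `g y = g z`. -/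
theorem eventually_notMem_dirichletSpectrum {ℓ : ℝ} (hℓ : 0 < ℓ) {z : ℂ}
    (hz : z ∉ dirichletSpectrum ℓ) : ∀ᶠ y in 𝓝 z, y ∉ dirichletSpectrum ℓ := by
  have hc := (hasDerivAt_spectralMap ℓ z).continuousAt
  have hev : ∀ᶠ x in 𝓝 (spectralMap ℓ z), x ∉ ({0, 2} : Set ℂ) \ {spectralMap ℓ z} :=
    ((((Set.finite_singleton (2 : ℂ)).insert 0).sdiff).isClosed.isOpen_compl).mem_nhds
      fun h => h.2 rfl
  filter_upwards [hc.eventually hev, (spectralMap_locally_bijective hℓ hz).2] with y h1 h2 hy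
  by_cases h : spectralMap ℓ y = spectralMap ℓ z
  · exact hz (h2 h ▸ hy)
  · exact h1 ⟨(spectralMap_mem_iff hℓ y).2 (Or.inr hy), h⟩

/-! ### Primitives on an interval -/

theorem AbsolutelyContinuousOnInterval.of_dist_le {X Y : Type*} [PseudoMetricSpace X]
    [PseudoMetricSpace Y] {f : ℝ → X} {g : ℝ → Y} {a b : ℝ}
    (hg : AbsolutelyContinuousOnInterval g a b)
    (h : ∀ x ∈ uIcc a b, ∀ y ∈ uIcc a b, dist (f x) (f y) ≤ dist (g x) (g y)) :
    AbsolutelyContinuousOnInterval f a b := by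
  refine squeeze_zero' (Filter.Eventually.of_forall fun _ =>
    Finset.sum_nonneg fun _ _ => dist_nonneg) ?_ hg
  rw [Filter.eventually_inf_principal]
  filter_upwards with I hI
  exact Finset.sum_le_sum fun i hi => h _ (hI.1 i hi).1 _ (hI.1 i hi).2

/-- The increments are dominated by those of the primitive of `‖w‖`, which reduces the claim to real
functions. -/
theorem IntervalIntegrable.absolutelyContinuousOnInterval_integral {E : Type*}
    [NormedAddCommGroup E] [NormedSpace ℝ E] {w : ℝ → E} {a b : ℝ}
    (hw : IntervalIntegrable w volume a b) :
    AbsolutelyContinuousOnInterval (fun x => ∫ t in a..x, w t) a b := by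
  refine (hw.norm.absolutelyContinuousOnInterval_intervalIntegral
    (left_mem_uIcc (a := a))).of_dist_le fun x hx y hy => ?_
  have h : ∀ z ∈ uIcc a b, IntervalIntegrable w volume a z := fun z hz =>
    hw.mono_set (uIcc_subset_uIcc_left hz)
  rw [dist_comm, dist_comm (∫ v in a..x, ‖w v‖), dist_eq_norm, dist_eq_norm,
    intervalIntegral.integral_interval_sub_left (h y hy) (h x hx),
    intervalIntegral.integral_interval_sub_left (h y hy).norm (h x hx).norm]
  exact intervalIntegral.norm_integral_le_abs_integral_norm

/-- `F` is absolutely continuous on `[0, ℓ]` with derivative `u`. -/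
structure IsPrimitive (ℓ : ℝ) (F u : ℝ → ℂ) : Prop where
  intervalIntegrable : IntervalIntegrable u volume 0 ℓ
  eq_add_integral : ∀ x ∈ Icc 0 ℓ, F x = F 0 + ∫ t in (0 : ℝ)..x, u t

namespace IsPrimitive

variable {ℓ : ℝ} {F K u v : ℝ → ℂ}

theorem intervalIntegrable_left (h : IsPrimitive ℓ F u) {x : ℝ} (hx : x ∈ Icc 0 ℓ) :
    IntervalIntegrable u volume 0 x :=
  h.intervalIntegrable.mono_set (by
    rw [uIcc_of_le hx.1, uIcc_of_le (hx.1.trans hx.2)]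
    exact Icc_subset_Icc_right hx.2)

theorem integral_eq (h : IsPrimitive ℓ F u) (hℓ : 0 ≤ ℓ) :
    ∫ t in (0 : ℝ)..ℓ, u t = F ℓ - F 0 := by
  rw [h.eq_add_integral ℓ ⟨hℓ, le_rfl⟩]
  ring

theorem continuousOn (h : IsPrimitive ℓ F u) : ContinuousOn F (Icc 0 ℓ) := by
  rcases lt_or_ge ℓ 0 with hℓ | hℓ
  · rw [Icc_eq_empty (not_le.2 hℓ)]
    exact continuousOn_empty _
  · have h1 := intervalIntegral.continuousOn_primitive_interval' h.intervalIntegrable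
      (left_mem_uIcc)
    rw [uIcc_of_le hℓ] at h1
    exact (h1.const_add (F 0)).congr h.eq_add_integral

theorem add (hF : IsPrimitive ℓ F u) (hK : IsPrimitive ℓ K v) :
    IsPrimitive ℓ (fun x => F x + K x) fun x => u x + v x := by
  refine ⟨hF.1.add hK.1, fun x hx => ?_⟩
  rw [intervalIntegral.integral_add (hF.intervalIntegrable_left hx)
    (hK.intervalIntegrable_left hx), hF.2 x hx, hK.2 x hx]
  ring

theorem const_mul (c : ℂ) (hF : IsPrimitive ℓ F u) :
    IsPrimitive ℓ (fun x => c * F x) fun x => c * u x := by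
  refine ⟨hF.1.const_mul c, fun x hx => ?_⟩
  rw [intervalIntegral.integral_const_mul, hF.2 x hx]
  ring

theorem sub (hF : IsPrimitive ℓ F u) (hK : IsPrimitive ℓ K v) :
    IsPrimitive ℓ (fun x => F x - K x) fun x => u x - v x := by
  refine ⟨hF.1.sub hK.1, fun x hx => ?_⟩
  rw [intervalIntegral.integral_sub (hF.intervalIntegrable_left hx)
    (hK.intervalIntegrable_left hx), hF.2 x hx, hK.2 x hx]
  ring

theorem conj (hF : IsPrimitive ℓ F u) :
    IsPrimitive ℓ (fun x => starRingEnd ℂ (F x)) fun x => starRingEnd ℂ (u x) := by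
  refine ⟨?_, fun x hx => ?_⟩
  · exact intervalIntegrable_iff.2
      (Complex.conjLIE.integrable_comp_iff.2 (intervalIntegrable_iff.1 hF.1))
  · rw [hF.2 x hx, map_add, intervalIntegral.integral_of_le hx.1,
      intervalIntegral.integral_of_le hx.1, integral_conj]

theorem of_hasDerivAt (h : ∀ x, HasDerivAt F (u x) x) (hu : Continuous u) :
    IsPrimitive ℓ F u := by
  refine ⟨hu.intervalIntegrable _ _, fun x _ => ?_⟩
  rw [intervalIntegral.integral_eq_sub_of_hasDerivAt (fun y _ => h y) (hu.intervalIntegrable _ _)]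
  ring

theorem integral (hu : IntervalIntegrable u volume 0 ℓ) :
    IsPrimitive ℓ (fun x => ∫ t in (0 : ℝ)..x, u t) u :=
  ⟨hu, fun x _ => by simp⟩

theorem congr (hF : IsPrimitive ℓ F u) (hℓ : 0 ≤ ℓ) (h1 : ∀ x ∈ Icc 0 ℓ, K x = F x)
    (h2 : ∀ x, v x = u x) : IsPrimitive ℓ K v := by
  rw [funext h2]
  refine ⟨hF.1, fun x hx => ?_⟩
  rw [h1 x hx, h1 0 (left_mem_Icc.2 hℓ), hF.2 x hx]

theorem congr_ae (hF : IsPrimitive ℓ F u) (hv : v =ᵐ[volume.restrict (Ioo 0 ℓ)] u)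
    (hℓ : 0 ≤ ℓ) :
    IsPrimitive ℓ F v := by
  refine ⟨?_, fun x hx => by rw [OrientedGraph.intervalIntegral_congr hx hv, ← hF.2 x hx]⟩
  have h := hF.1
  rw [intervalIntegrable_iff_integrableOn_Ioo_of_le hℓ] at h ⊢
  exact h.congr_fun_ae hv.symm

/-- The product minus the integral of its expected derivative is absolutely continuous with
derivative zero almost everywhere, hence constant. All integrations by parts below rest on this. -/
theorem mul (hF : IsPrimitive ℓ F u) (hK : IsPrimitive ℓ K v) (hℓ : 0 ≤ ℓ) :
    IsPrimitive ℓ (fun x => F x * K x) fun x => u x * K x + F x * v x := by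
  have huI : uIcc 0 ℓ = Icc 0 ℓ := uIcc_of_le hℓ
  have hint : IntervalIntegrable (fun x => u x * K x + F x * v x) volume 0 ℓ :=
    (hF.1.mul_continuousOn (huI ▸ hK.continuousOn)).add
      (hK.1.continuousOn_mul (huI ▸ hF.continuousOn))
  refine ⟨hint, ?_⟩
  -- `F` and `K` are known only on `[0, ℓ]`; `P` and `Q` agree with them there and are primitives on
  -- the whole line.
  let P : ℝ → ℂ := fun x => F 0 + ∫ t in (0 : ℝ)..x, u t
  let Q : ℝ → ℂ := fun x => K 0 + ∫ t in (0 : ℝ)..x, v t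
  have hac : ∀ {w : ℝ → ℂ}, IntervalIntegrable w volume 0 ℓ →
      AbsolutelyContinuousOnInterval (fun x => ∫ t in (0 : ℝ)..x, w t) 0 ℓ := fun hw =>
    hw.absolutelyContinuousOnInterval_integral
  have hconst : ∀ c : ℂ, AbsolutelyContinuousOnInterval (fun _ : ℝ => c) 0 ℓ := fun c =>
    (LipschitzWith.const c).lipschitzOnWith.absolutelyContinuousOnInterval
  have hP : AbsolutelyContinuousOnInterval P 0 ℓ := (hconst (F 0)).add (hac hF.1)
  have hQ : AbsolutelyContinuousOnInterval Q 0 ℓ := (hconst (K 0)).add (hac hK.1)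
  have hPQ : AbsolutelyContinuousOnInterval
      (P • Q - fun x => ∫ t in (0 : ℝ)..x, (u t * K t + F t * v t)) 0 ℓ :=
    (hP.smul hQ).sub (hac hint)
  have hderiv : ∀ᵐ x, x ∈ uIcc 0 ℓ → HasDerivAt
      (P • Q - fun x => ∫ t in (0 : ℝ)..x, (u t * K t + F t * v t)) 0 x := by
    filter_upwards [hF.1.ae_hasDerivAt_integral, hK.1.ae_hasDerivAt_integral,
      hint.ae_hasDerivAt_integral] with x h1 h2 h3 hx
    have hP' : HasDerivAt P (u x) x := (h1 hx 0 left_mem_uIcc).const_add (F 0)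
    have hQ' : HasDerivAt Q (v x) x := (h2 hx 0 left_mem_uIcc).const_add (K 0)
    refine ((hP'.mul hQ').sub (h3 hx 0 left_mem_uIcc)).congr_deriv ?_
    rw [hF.2 x (huI ▸ hx), hK.2 x (huI ▸ hx)]
    exact sub_self _
  obtain ⟨C, hC⟩ := hPQ.const_of_ae_hasDerivAt_zero hderiv
  intro x hx
  have h0 := hC 0 left_mem_uIcc
  have h1 := hC x (huI ▸ hx)
  simp only [P, Q, Pi.sub_apply, smul_eq_mul, Pi.mul_apply, intervalIntegral.integral_same,
    add_zero, sub_zero] at h0 h1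
  rw [← hF.2 x hx, ← hK.2 x hx, ← h0] at h1
  rw [← h1]
  ring

end IsPrimitive

/-! ### The differential equation on a single edge -/

namespace OrientedGraph

theorem memLp_of_continuousOn {ℓ : ℝ} {f : ℝ → ℂ} (hf : ContinuousOn f (Icc 0 ℓ)) :
    MemLp f 2 (volume.restrict (Ioo 0 ℓ)) := by
  obtain ⟨C, hC⟩ := isCompact_Icc.exists_bound_of_continuousOn hf
  refine MemLp.of_bound ((hf.mono Ioo_subset_Icc_self).aestronglyMeasurable measurableSet_Ioo) C ?_
  filter_upwards [ae_restrict_mem measurableSet_Ioo] with x hx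
  exact hC x (Ioo_subset_Icc_self hx)

/-- The conjugate offsets the conjugate-linear first slot of the inner product that defines
`kernelIntegral`. -/
theorem memLp_indicator_conj (ℓ : ℝ) (k : C(ℝ, ℂ)) (x : ℝ) :
    MemLp ((Ioc 0 x).indicator fun t => starRingEnd ℂ (k t)) 2 (volume.restrict (Ioo 0 ℓ)) :=
  (memLp_of_continuousOn (Complex.continuous_conj.comp k.continuous).continuousOn).indicator
    measurableSet_Ioc

/-- The functional `u ↦ ∫ t in 0..x, k t * u t` on `L²(0, ℓ)`, for `x` in `[0, ℓ]`. -/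
def kernelIntegral (ℓ : ℝ) (k : C(ℝ, ℂ)) (x : ℝ) : IntervalL2 ℓ →L[ℂ] ℂ :=
  innerSL ℂ ((memLp_indicator_conj ℓ k x).toLp _)

theorem kernelIntegral_apply {ℓ : ℝ} (k : C(ℝ, ℂ)) {x : ℝ} (hx : x ∈ Icc 0 ℓ)
    (u : IntervalL2 ℓ) : kernelIntegral ℓ k x u = ∫ t in (0 : ℝ)..x, k t * u t := by
  rw [kernelIntegral, innerSL_apply_apply, L2.inner_def, intervalIntegral.integral_of_le hx.1,
    integral_Ioc_eq_integral_Ioo]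
  have hsub : Ioo 0 x ⊆ Ioo 0 ℓ := Ioo_subset_Ioo_right hx.2
  have h1 : ∫ t in Ioo 0 x, k t * u t
      = ∫ t in Ioo 0 ℓ, (Ioo 0 x).indicator (fun t => k t * u t) t := by
    rw [setIntegral_indicator measurableSet_Ioo, inter_eq_right.2 hsub]
  rw [h1]
  refine integral_congr_ae ?_
  have hne : ∀ᵐ t ∂(volume.restrict (Ioo 0 ℓ)), t ≠ x :=
    ae_restrict_of_ae (by simp [ae_iff, measure_singleton])
  filter_upwards [(memLp_indicator_conj ℓ k x).coeFn_toLp, hne] with t ht htx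
  rw [ht]
  by_cases hm : t ∈ Ioo 0 x
  · rw [indicator_of_mem hm, indicator_of_mem (Ioo_subset_Ioc_self hm)]
    simp [mul_comm]
  · have hm' : t ∉ Ioc 0 x := fun h => hm ⟨h.1, lt_of_le_of_ne h.2 htx⟩
    rw [indicator_of_notMem hm, indicator_of_notMem hm', inner_zero_left]

theorem intervalIntegrable_mul {ℓ : ℝ} (hℓ : 0 ≤ ℓ) (k : C(ℝ, ℂ)) (u : IntervalL2 ℓ) :
    IntervalIntegrable (fun t => k t * u t) volume 0 ℓ :=
  (intervalIntegrable_of_intervalL2 (right_mem_Icc.2 hℓ) u).continuousOn_mul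
    k.continuous.continuousOn

theorem isPrimitive_kernelIntegral {ℓ : ℝ} (hℓ : 0 ≤ ℓ) (k : C(ℝ, ℂ)) (u : IntervalL2 ℓ) :
    IsPrimitive ℓ (fun x => kernelIntegral ℓ k x u) fun t => k t * u t :=
  (IsPrimitive.integral (intervalIntegrable_mul hℓ k u)).congr hℓ
    (fun _ hx => kernelIntegral_apply k hx u) fun _ => rfl

theorem kernelIntegral_zero {ℓ : ℝ} (hℓ : 0 ≤ ℓ) (k : C(ℝ, ℂ)) (u : IntervalL2 ℓ) :
    kernelIntegral ℓ k 0 u = 0 := by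
  rw [kernelIntegral_apply k (left_mem_Icc.2 hℓ), intervalIntegral.integral_same]

/-- A family of functionals that depends continuously on `x` in `[0, ℓ]` defines a bounded operator
with values in `L²(0, ℓ)`. -/
theorem exists_continuousLinearMap_intervalL2 {Y : Type*} [NormedAddCommGroup Y]
    [NormedSpace ℂ Y] [CompleteSpace Y] {ℓ : ℝ} (hℓ : 0 ≤ ℓ) (L : ℝ → Y →L[ℂ] ℂ)
    (hL : ∀ y, ContinuousOn (fun x => L x y) (Icc 0 ℓ)) :
    ∃ T : Y →L[ℂ] IntervalL2 ℓ, ∀ y, T y =ᵐ[volume.restrict (Ioo 0 ℓ)] fun x => L x y := by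
  -- Continuity on a compact interval gives pointwise bounds; the uniform boundedness principle
  -- makes them uniform in `x`.
  obtain ⟨C, hC⟩ := banach_steinhaus (g := fun x : Icc (0 : ℝ) ℓ => L x) fun y => by
    obtain ⟨C, hC⟩ := isCompact_Icc.exists_bound_of_continuousOn (hL y)
    exact ⟨C, fun x => hC x x.2⟩
  have hm := fun y => memLp_of_continuousOn (hL y)
  let T : Y →ₗ[ℂ] IntervalL2 ℓ :=
    { toFun := fun y => (hm y).toLp _
      map_add' := fun y y' => by
        rw [← MemLp.toLp_add, MemLp.toLp_eq_toLp_iff]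
        exact Filter.Eventually.of_forall fun x => map_add (L x) y y'
      map_smul' := fun c y => by
        rw [RingHom.id_apply, ← MemLp.toLp_const_smul, MemLp.toLp_eq_toLp_iff]
        exact Filter.Eventually.of_forall fun x => map_smul (L x) c y }
  refine ⟨T.mkContinuous (measureUnivNNReal (volume.restrict (Ioo 0 ℓ)) ^ ((2 : ℝ≥0∞).toReal)⁻¹ * C)
    fun y => ?_, fun y => (hm y).coeFn_toLp⟩
  rw [mul_assoc]
  have hC0 : 0 ≤ C := (norm_nonneg _).trans (hC ⟨0, left_mem_Icc.2 hℓ⟩)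
  refine Lp.norm_le_of_ae_bound (by positivity) ?_
  filter_upwards [(hm y).coeFn_toLp, ae_restrict_mem measurableSet_Ioo] with x hx hxm
  change ‖(hm y).toLp _ x‖ ≤ _
  rw [hx]
  exact (L x).le_of_opNorm_le (hC ⟨x, Ioo_subset_Icc_self hxm⟩) y

/-- The data for the equation `-f'' - z f = u` on an edge: the boundary values `f 0` and `f ℓ`, and
the function `u`. -/
abbrev EdgeData (ℓ : ℝ) : Type := ℂ × ℂ × IntervalL2 ℓ

variable (ℓ : ℝ) (z : ℂ)

/-- `sinSol z` as a bundled continuous map. -/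
def sinMap : C(ℝ, ℂ) := ⟨sinSol z, continuous_sinSol z⟩

/-- `cosSol z` as a bundled continuous map. -/
def cosMap : C(ℝ, ℂ) := ⟨cosSol z, continuous_cosSol z⟩

/-- The source functional at the start of an edge. -/
def startFunctional : IntervalL2 ℓ →L[ℂ] ℂ :=
  sinSol z ℓ • kernelIntegral ℓ (cosMap z) ℓ - cosSol z ℓ • kernelIntegral ℓ (sinMap z) ℓ

/-- The source functional at the end of an edge. -/
def endFunctional : IntervalL2 ℓ →L[ℂ] ℂ := kernelIntegral ℓ (sinMap z) ℓ

/-- The initial slope of the solution of the boundary value problem. -/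
def initialSlope (y : EdgeData ℓ) : ℂ :=
  (y.2.1 - cosSol z ℓ * y.1 + startFunctional ℓ z y.2.2) / sinSol z ℓ

/-- The value at `x` of the solution of the boundary value problem. -/
def edgeValue (x : ℝ) (y : EdgeData ℓ) : ℂ :=
  y.1 * cosSol z x + initialSlope ℓ z y * sinSol z x
    - sinSol z x * kernelIntegral ℓ (cosMap z) x y.2.2
    + cosSol z x * kernelIntegral ℓ (sinMap z) x y.2.2

/-- The derivative at `x` of the solution of the boundary value problem. -/
def edgeSlope (x : ℝ) (y : EdgeData ℓ) : ℂ :=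
  y.1 * (-z * sinSol z x) + initialSlope ℓ z y * cosSol z x
    - cosSol z x * kernelIntegral ℓ (cosMap z) x y.2.2
    - z * (sinSol z x * kernelIntegral ℓ (sinMap z) x y.2.2)

variable {ℓ z}

/-- Variation of constants: the terms in which the two integrals are differentiated cancel, so the
slope does not involve `u` pointwise. -/
theorem isPrimitive_edgeValue (hℓ : 0 ≤ ℓ) (y : EdgeData ℓ) :
    IsPrimitive ℓ (fun x => edgeValue ℓ z x y) fun x => edgeSlope ℓ z x y := by
  have hs : IsPrimitive ℓ (sinSol z) (cosSol z) :=
    .of_hasDerivAt (hasDerivAt_sinSol z) (continuous_cosSol z)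
  have hc : IsPrimitive ℓ (cosSol z) fun x => -z * sinSol z x :=
    .of_hasDerivAt (hasDerivAt_cosSol z) ((continuous_sinSol z).const_mul _)
  have hC := isPrimitive_kernelIntegral hℓ (cosMap z) y.2.2
  have hS := isPrimitive_kernelIntegral hℓ (sinMap z) y.2.2
  refine ((((hc.const_mul y.1).add (hs.const_mul (initialSlope ℓ z y))).sub (hs.mul hC hℓ)).add
    (hc.mul hS hℓ)).congr hℓ (fun x _ => rfl) fun x => ?_
  simp only [edgeSlope, sinMap, cosMap, ContinuousMap.coe_mk]
  ring

theorem isPrimitive_edgeSlope (hℓ : 0 ≤ ℓ) (y : EdgeData ℓ) :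
    IsPrimitive ℓ (fun x => edgeSlope ℓ z x y) fun x => -(z * edgeValue ℓ z x y) - y.2.2 x := by
  have hs : IsPrimitive ℓ (sinSol z) (cosSol z) :=
    .of_hasDerivAt (hasDerivAt_sinSol z) (continuous_cosSol z)
  have hc : IsPrimitive ℓ (cosSol z) fun x => -z * sinSol z x :=
    .of_hasDerivAt (hasDerivAt_cosSol z) ((continuous_sinSol z).const_mul _)
  have hC := isPrimitive_kernelIntegral hℓ (cosMap z) y.2.2
  have hS := isPrimitive_kernelIntegral hℓ (sinMap z) y.2.2
  refine (((((hs.const_mul (-z)).const_mul y.1).add (hc.const_mul (initialSlope ℓ z y))).sub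
    (hc.mul hC hℓ)).sub ((hs.mul hS hℓ).const_mul z)).congr hℓ (fun x _ => rfl) fun x => ?_
  simp only [edgeValue, sinMap, cosMap, ContinuousMap.coe_mk]
  linear_combination (y.2.2 x) * cosSol_sq_add z x

theorem edgeValue_zero (hℓ : 0 ≤ ℓ) (y : EdgeData ℓ) : edgeValue ℓ z 0 y = y.1 := by
  simp [edgeValue, kernelIntegral_zero hℓ]

theorem edgeValue_right (hz : sinSol z ℓ ≠ 0) (y : EdgeData ℓ) : edgeValue ℓ z ℓ y = y.2.1 := by
  simp only [edgeValue, initialSlope, startFunctional, _root_.sub_apply,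
    _root_.smul_apply, smul_eq_mul]
  field_simp
  ring

theorem edgeSlope_zero (hℓ : 0 ≤ ℓ) (y : EdgeData ℓ) :
    edgeSlope ℓ z 0 y = initialSlope ℓ z y := by
  simp [edgeSlope, kernelIntegral_zero hℓ]

/-- Up to sign this has the same shape as `initialSlope`: the slope into the edge is (other value -
`c` own value + source) / `s` at either end, so orientation plays no role at a vertex. -/
theorem edgeSlope_right (hz : sinSol z ℓ ≠ 0) (y : EdgeData ℓ) :
    edgeSlope ℓ z ℓ y =
      -((y.1 - cosSol z ℓ * y.2.1 + endFunctional ℓ z y.2.2) / sinSol z ℓ) := by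
  simp only [edgeSlope, initialSlope, startFunctional, endFunctional,
    _root_.sub_apply, _root_.smul_apply, smul_eq_mul]
  field_simp
  linear_combination (-y.1 - kernelIntegral ℓ (sinMap z) ℓ y.2.2) * cosSol_sq_add z ℓ

theorem exists_edgeValue_clm (x : ℝ) :
    ∃ L : EdgeData ℓ →L[ℂ] ℂ, ∀ y, L y = edgeValue ℓ z x y := by
  let p := ContinuousLinearMap.fst ℂ ℂ (ℂ × IntervalL2 ℓ)
  let q := (ContinuousLinearMap.fst ℂ ℂ (IntervalL2 ℓ)).comp
    (ContinuousLinearMap.snd ℂ ℂ (ℂ × IntervalL2 ℓ))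
  let r := (ContinuousLinearMap.snd ℂ ℂ (IntervalL2 ℓ)).comp
    (ContinuousLinearMap.snd ℂ ℂ (ℂ × IntervalL2 ℓ))
  refine ⟨cosSol z x • p + sinSol z x • ((sinSol z ℓ)⁻¹ •
      (q - cosSol z ℓ • p + (startFunctional ℓ z).comp r))
    - sinSol z x • (kernelIntegral ℓ (cosMap z) x).comp r
    + cosSol z x • (kernelIntegral ℓ (sinMap z) x).comp r, fun y => ?_⟩
  simp only [p, q, r, edgeValue, initialSlope, _root_.add_apply,
    _root_.sub_apply, _root_.smul_apply, ContinuousLinearMap.comp_apply,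
    ContinuousLinearMap.coe_fst', ContinuousLinearMap.coe_snd', smul_eq_mul]
  ring

theorem exists_edgeSlope_clm (x : ℝ) :
    ∃ L : EdgeData ℓ →L[ℂ] ℂ, ∀ y, L y = edgeSlope ℓ z x y := by
  let p := ContinuousLinearMap.fst ℂ ℂ (ℂ × IntervalL2 ℓ)
  let q := (ContinuousLinearMap.fst ℂ ℂ (IntervalL2 ℓ)).comp
    (ContinuousLinearMap.snd ℂ ℂ (ℂ × IntervalL2 ℓ))
  let r := (ContinuousLinearMap.snd ℂ ℂ (IntervalL2 ℓ)).comp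
    (ContinuousLinearMap.snd ℂ ℂ (ℂ × IntervalL2 ℓ))
  refine ⟨(-z * sinSol z x) • p + cosSol z x • ((sinSol z ℓ)⁻¹ •
      (q - cosSol z ℓ • p + (startFunctional ℓ z).comp r))
    - cosSol z x • (kernelIntegral ℓ (cosMap z) x).comp r
    - (z * sinSol z x) • (kernelIntegral ℓ (sinMap z) x).comp r, fun y => ?_⟩
  simp only [p, q, r, edgeSlope, initialSlope, _root_.add_apply,
    _root_.sub_apply, _root_.smul_apply, ContinuousLinearMap.comp_apply,
    ContinuousLinearMap.coe_fst', ContinuousLinearMap.coe_snd', smul_eq_mul]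
  ring

theorem exists_edgeSolution (hℓ : 0 ≤ ℓ) :
    ∃ T : EdgeData ℓ →L[ℂ] IntervalL2 ℓ,
      ∀ y, T y =ᵐ[volume.restrict (Ioo 0 ℓ)] fun x => edgeValue ℓ z x y := by
  choose L hL using fun x => exists_edgeValue_clm (ℓ := ℓ) (z := z) x
  obtain ⟨T, hT⟩ := exists_continuousLinearMap_intervalL2 hℓ L fun y => by
    simpa only [hL] using (isPrimitive_edgeValue hℓ y).continuousOn
  exact ⟨T, fun y => by simpa only [hL] using hT y⟩

theorem exists_edgeDerivative (hℓ : 0 ≤ ℓ) :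
    ∃ T : EdgeData ℓ →L[ℂ] IntervalL2 ℓ,
      ∀ y, T y =ᵐ[volume.restrict (Ioo 0 ℓ)] fun x => edgeSlope ℓ z x y := by
  choose L hL using fun x => exists_edgeSlope_clm (ℓ := ℓ) (z := z) x
  obtain ⟨T, hT⟩ := exists_continuousLinearMap_intervalL2 hℓ L fun y => by
    simpa only [hL] using (isPrimitive_edgeSlope hℓ y).continuousOn
  exact ⟨T, fun y => by simpa only [hL] using hT y⟩

/-- The source functionals of `-f'' - z f`, for `f` vanishing at both ends, are determined by the
slopes of `f` at the ends. -/
theorem sourceFunctionals_of_isPrimitive (hℓ : 0 ≤ ℓ) {f f' f'' : ℝ → ℂ} {u : IntervalL2 ℓ}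
    (hf : IsPrimitive ℓ f f') (hf' : IsPrimitive ℓ f' f'') (h0 : f 0 = 0) (h1 : f ℓ = 0)
    (hu : u =ᵐ[volume.restrict (Ioo 0 ℓ)] fun x => -f'' x - z * f x) :
    startFunctional ℓ z u = sinSol z ℓ * f' 0 ∧ endFunctional ℓ z u = -(sinSol z ℓ * f' ℓ) := by
  have hs : IsPrimitive ℓ (sinSol z) (cosSol z) :=
    .of_hasDerivAt (hasDerivAt_sinSol z) (continuous_cosSol z)
  have hc : IsPrimitive ℓ (cosSol z) fun x => -z * sinSol z x :=
    .of_hasDerivAt (hasDerivAt_cosSol z) ((continuous_sinSol z).const_mul _)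
  have hS : kernelIntegral ℓ (sinMap z) ℓ u = -(sinSol z ℓ * f' ℓ) := by
    -- Lagrange's identity: with `c`, `s` the fundamental solutions, `(c f - s f')' = s (-f'' - z
    -- f)`. Likewise `(-z s f - c f')' = c (-f'' - z f)` below.
    have h := (((hc.mul hf hℓ).sub (hs.mul hf' hℓ)).congr_ae
      (v := fun t => sinMap z t * u t) (by
        filter_upwards [hu] with x hx
        rw [hx]
        simp only [sinMap, ContinuousMap.coe_mk]
        ring) hℓ).integral_eq hℓ
    rw [kernelIntegral_apply _ (right_mem_Icc.2 hℓ), h, h0, h1]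
    simp
  have hC : kernelIntegral ℓ (cosMap z) ℓ u = f' 0 - cosSol z ℓ * f' ℓ := by
    have h := ((((hs.const_mul (-z)).mul hf hℓ).sub (hc.mul hf' hℓ)).congr_ae
      (v := fun t => cosMap z t * u t) (by
        filter_upwards [hu] with x hx
        rw [hx]
        simp only [cosMap, ContinuousMap.coe_mk]
        ring) hℓ).integral_eq hℓ
    rw [kernelIntegral_apply _ (right_mem_Icc.2 hℓ), h, h0, h1]
    simp
    ring
  simp only [startFunctional, endFunctional, _root_.sub_apply, _root_.smul_apply, smul_eq_mul, hS,
    hC]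
  exact ⟨by ring, trivial⟩

theorem hasDerivAt_cubic (a b c d : ℂ) (x : ℝ) :
    HasDerivAt (fun x : ℝ => a + b * x + c * x ^ 2 + d * x ^ 3)
      (b + 2 * c * x + 3 * d * x ^ 2) x := by
  have h := (((((hasDerivAt_id (x : ℂ)).const_mul b).const_add a).add
    ((hasDerivAt_pow 2 (x : ℂ)).const_mul c)).add
    ((hasDerivAt_pow 3 (x : ℂ)).const_mul d)).comp_ofReal
  refine h.congr_deriv ?_
  push_cast
  ring

/-- The two source functionals are jointly surjective. -/
theorem exists_source (hℓ : 0 < ℓ) (hz : sinSol z ℓ ≠ 0) (p q : ℂ) :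
    ∃ u : IntervalL2 ℓ, startFunctional ℓ z u = p ∧ endFunctional ℓ z u = q := by
  have hℓ' : (ℓ : ℂ) ≠ 0 := by exact_mod_cast hℓ.ne'
  -- `A` and `B` are the slopes at 0 and `ℓ` that produce `p` and `q`; the cubic `f` below vanishes
  -- at both ends and has these slopes.
  let A : ℂ := p / sinSol z ℓ
  let B : ℂ := -(q / sinSol z ℓ)
  let b : ℂ := -(2 * A + B) / ℓ
  let c : ℂ := (A + B) / ℓ ^ 2
  let f : ℝ → ℂ := fun x => 0 + A * x + b * x ^ 2 + c * x ^ 3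
  let f' : ℝ → ℂ := fun x => A + 2 * b * x + 3 * c * x ^ 2 + 0 * x ^ 3
  let f'' : ℝ → ℂ := fun x => 2 * b + 2 * (3 * c) * x + 3 * 0 * x ^ 2
  have hf : IsPrimitive ℓ f f' :=
    .of_hasDerivAt (fun x => (hasDerivAt_cubic 0 A b c x).congr_deriv (by simp [f']))
      (by fun_prop)
  have hf' : IsPrimitive ℓ f' f'' :=
    .of_hasDerivAt (fun x => hasDerivAt_cubic A (2 * b) (3 * c) 0 x) (by fun_prop)
  have hm : MemLp (fun x => -f'' x - z * f x) 2 (volume.restrict (Ioo 0 ℓ)) :=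
    memLp_of_continuousOn (by fun_prop)
  have h := sourceFunctionals_of_isPrimitive hℓ.le hf hf' (by simp [f])
    (by simp only [f, b, c]; field_simp; ring) hm.coeFn_toLp
  refine ⟨hm.toLp _, h.1.trans ?_, h.2.trans ?_⟩
  · simp only [f', A]
    field_simp
    simp
  · have hB : f' ℓ = B := by
      simp only [f', b, c]
      field_simp
      ring
    rw [hB]
    simp only [B]
    field_simp

/-! ### Square summable families -/

theorem memℓp_two_iff {ι : Type*} {X : ι → Type*} [∀ i, NormedAddCommGroup (X i)]
    {f : ∀ i, X i} : Memℓp f 2 ↔ ∑' i, ‖f i‖ₑ ^ 2 < ∞ := by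
  rw [memℓp_gen_iff (by norm_num), lt_top_iff_ne_top]
  have h : ∀ i, ‖f i‖ₑ ^ 2 = ((‖f i‖₊ ^ 2 : NNReal) : ℝ≥0∞) := fun i => by
    rw [ENNReal.coe_pow]
    rfl
  simp_rw [h]
  rw [ENNReal.tsum_coe_ne_top_iff_summable, ← NNReal.summable_coe]
  simp

theorem _root_.Memℓp.clm_comp {ι X Y : Type*} [NormedAddCommGroup X] [NormedSpace ℂ X]
    [NormedAddCommGroup Y] [NormedSpace ℂ Y] (T : X →L[ℂ] Y) {f : ι → X} (hf : Memℓp f 2) :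
    Memℓp (fun i => T (f i)) 2 := by
  rw [memℓp_two_iff] at hf ⊢
  refine lt_of_le_of_lt (ENNReal.tsum_le_tsum fun i => ?_)
    (ENNReal.tsum_mul_left.trans_lt (ENNReal.mul_lt_top
      (ENNReal.pow_lt_top (n := 2) (enorm_lt_top (x := T))) hf))
  rw [← mul_pow]
  gcongr
  exact T.le_opENorm _

theorem _root_.Memℓp.prodMk {ι X Y : Type*} [NormedAddCommGroup X] [NormedAddCommGroup Y]
    {f : ι → X} {g : ι → Y} (hf : Memℓp f 2) (hg : Memℓp g 2) :
    Memℓp (fun i => (f i, g i)) 2 := by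
  rw [memℓp_two_iff] at hf hg ⊢
  refine lt_of_le_of_lt (ENNReal.tsum_le_tsum fun i => ?_)
    (ENNReal.tsum_add.trans_lt (ENNReal.add_lt_top.2 ⟨hf, hg⟩))
  rcases max_choice ‖f i‖ ‖g i‖ with h | h
  · rw [enorm_eq_iff_norm_eq.2 (Prod.norm_mk (f i) (g i) ▸ h : ‖(f i, g i)‖ = ‖f i‖)]
    exact le_self_add
  · rw [enorm_eq_iff_norm_eq.2 (Prod.norm_mk (f i) (g i) ▸ h : ‖(f i, g i)‖ = ‖g i‖)]
    exact le_add_self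

theorem _root_.Memℓp.summable_conj_mul {ι : Type*} {x y : ι → ℂ} (hx : Memℓp x 2) (hy : Memℓp y 2) :
    Summable fun i => starRingEnd ℂ (x i) * y i := by
  have h := lp.summable_inner (𝕜 := ℂ) (⟨x, hx⟩ : lp (fun _ : ι => ℂ) 2) ⟨y, hy⟩
  refine h.congr fun i => ?_
  rw [RCLike.inner_apply, mul_comm]

/-! ### Edge sums regrouped at the vertices -/

section Graph

variable {V E : Type*} {G : OrientedGraph V E}

/-- Every edge occurs exactly once among the outgoing and once among the incoming edges; summability
permits the regrouping. -/
theorem tsum_edges_eq_tsum_vertices {x y : E → ℂ} (hx : Summable x) (hy : Summable y) :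
    ∑' e, x e + ∑' e, y e = ∑' v, (∑ e ∈ G.outEdges v, x e + ∑ e ∈ G.inEdges v, y e) := by
  have key : ∀ (t : E → V) (s : V → Finset E), (∀ e v, e ∈ s v ↔ t e = v) → ∀ {x : E → ℂ},
      Summable x → HasSum (fun v => ∑ e ∈ s v, x e) (∑' e, x e) := by
    intro t s hs x hx
    have h := ((Equiv.sigmaFiberEquiv t).hasSum_iff.2 hx.hasSum)
    refine h.sigma fun v => ?_
    have h2 := (s v).hasSum x
    exact (Equiv.hasSum_iff (Equiv.subtypeEquivRight fun e => (hs e v).symm)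
      (f := fun e : {e // e ∈ s v} => x e)).2 h2
  have h1 := key G.src G.outEdges (fun e v => by simp [outEdges]) hx
  have h2 := key G.tgt G.inEdges (fun e v => by simp [inEdges]) hy
  exact (h1.add h2).tsum_eq.symm

/-- A vertex is an edge end `deg v` times, so the weighted sum over vertices equals the sum over
both ends of all edges. -/
theorem memLp_degMeasure_iff_memℓp {a : V → ℂ} :
    MemLp a 2 G.degMeasure ↔ Memℓp (fun e => a (G.src e)) 2 ∧ Memℓp (fun e => a (G.tgt e)) 2 := by
  rw [memLp_degMeasure_iff, memℓp_two_iff, memℓp_two_iff,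
    ← G.tsum_neighbours (fun v => ‖a v‖ₑ ^ 2), ENNReal.tsum_add,
    G.tsum_sum_outEdges (fun e => ‖a (G.tgt e)‖ₑ ^ 2),
    G.tsum_sum_inEdges (fun e => ‖a (G.src e)‖ₑ ^ 2), ENNReal.add_lt_top, and_comm]

variable (G) in
/-- The average at a vertex `v` of a function `x` on the edges starting at `v` and a function `y`
on the edges ending at `v`. -/
def vertexAverage (x y : E → ℂ) (v : V) : ℂ :=
  (G.deg v : ℂ)⁻¹ * (∑ e ∈ G.outEdges v, x e + ∑ e ∈ G.inEdges v, y e)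

/-- The factor `deg v` lost in Cauchy–Schwarz and the weight `deg v` are both absorbed by the
squared prefactor of the average. -/
theorem deg_mul_vertexAverage_le (x y : E → ℂ) (v : V) :
    (G.deg v : ℝ≥0∞) * ‖G.vertexAverage x y v‖ₑ ^ 2 ≤
      ∑ e ∈ G.outEdges v, ‖x e‖ₑ ^ 2 + ∑ e ∈ G.inEdges v, ‖y e‖ₑ ^ 2 := by
  have hreal : (G.deg v : ℝ) * ‖G.vertexAverage x y v‖ ^ 2 ≤
      ∑ e ∈ G.outEdges v, ‖x e‖ ^ 2 + ∑ e ∈ G.inEdges v, ‖y e‖ ^ 2 := by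
    rcases Nat.eq_zero_or_pos (G.deg v) with h0 | hpos
    · rw [h0, Nat.cast_zero, zero_mul]
      positivity
    have hd : (0 : ℝ) < G.deg v := by exact_mod_cast hpos
    have hcard : (((G.outEdges v).disjSum (G.inEdges v)).card : ℝ) = G.deg v := by
      rw [Finset.card_disjSum, deg]
    have h1 : ‖∑ e ∈ G.outEdges v, x e + ∑ e ∈ G.inEdges v, y e‖ ^ 2 ≤
        G.deg v * (∑ e ∈ G.outEdges v, ‖x e‖ ^ 2 + ∑ e ∈ G.inEdges v, ‖y e‖ ^ 2) := by
      have h2 := Finset.sum_disjSum (G.outEdges v) (G.inEdges v) (Sum.elim x y)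
      have h3 := Finset.sum_disjSum (G.outEdges v) (G.inEdges v)
        (fun i => ‖Sum.elim x y i‖ ^ 2)
      simp only [Sum.elim_inl, Sum.elim_inr] at h2 h3
      rw [← h2, ← h3, ← hcard]
      exact (pow_le_pow_left₀ (norm_nonneg _) (norm_sum_le _ _) 2).trans sq_sum_le_card_mul_sum_sq
    rw [vertexAverage, norm_mul, norm_inv, Complex.norm_natCast, mul_pow]
    calc _ = (G.deg v : ℝ)⁻¹ * ‖∑ e ∈ G.outEdges v, x e + ∑ e ∈ G.inEdges v, y e‖ ^ 2 := by
          field_simp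
      _ ≤ (G.deg v : ℝ)⁻¹ * (G.deg v *
          (∑ e ∈ G.outEdges v, ‖x e‖ ^ 2 + ∑ e ∈ G.inEdges v, ‖y e‖ ^ 2)) := by gcongr
      _ = _ := by field_simp
  have hsq : ∀ z : ℂ, ‖z‖ₑ ^ 2 = ENNReal.ofReal (‖z‖ ^ 2) := fun z => by
    rw [ENNReal.ofReal_pow (norm_nonneg z), ofReal_norm]
  have h := ENNReal.ofReal_le_ofReal hreal
  rw [ENNReal.ofReal_add (by positivity) (by positivity), ENNReal.ofReal_mul (by positivity),
    ENNReal.ofReal_sum_of_nonneg (fun _ _ => by positivity),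
    ENNReal.ofReal_sum_of_nonneg (fun _ _ => by positivity)] at h
  simpa only [hsq, ENNReal.ofReal_natCast] using h

theorem memLp_vertexAverage {x y : E → ℂ} (hx : Memℓp x 2) (hy : Memℓp y 2) :
    MemLp (G.vertexAverage x y) 2 G.degMeasure := by
  rw [memLp_degMeasure_iff]
  rw [memℓp_two_iff] at hx hy
  refine lt_of_le_of_lt (ENNReal.tsum_le_tsum (G.deg_mul_vertexAverage_le x y)) ?_
  rw [ENNReal.tsum_add, G.tsum_sum_outEdges (fun e => ‖x e‖ₑ ^ 2),
    G.tsum_sum_inEdges (fun e => ‖y e‖ₑ ^ 2)]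
  exact ENNReal.add_lt_top.2 ⟨hx, hy⟩

/-! ### The space `ℓ²(V)` as a space of functions -/

/-- Every vertex is an atom of positive mass, so elements of `ℓ²(V)` may be evaluated at vertices.
-/
theorem eq_of_ae_degMeasure (hd : ∀ v, G.deg v ≠ 0) {a b : V → ℂ}
    (h : a =ᵐ[G.degMeasure] b) (v : V) : a v = b v :=
  (G.ae_degMeasure_iff fun v => a v = b v).1 h v (hd v)

theorem vertexL2_ext {a b : G.VertexL2} (h : ∀ v, a v = b v) : a = b :=
  Lp.ext (Filter.Eventually.of_forall h)

theorem vertexL2_add_apply (hd : ∀ v, G.deg v ≠ 0) (a b : G.VertexL2) (v : V) :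
    (a + b : G.VertexL2) v = a v + b v :=
  eq_of_ae_degMeasure hd (Lp.coeFn_add a b) v

theorem vertexL2_sub_apply (hd : ∀ v, G.deg v ≠ 0) (a b : G.VertexL2) (v : V) :
    (a - b : G.VertexL2) v = a v - b v :=
  eq_of_ae_degMeasure hd (Lp.coeFn_sub a b) v

theorem vertexL2_smul_apply (hd : ∀ v, G.deg v ≠ 0) (c : ℂ) (a : G.VertexL2) (v : V) :
    (c • a : G.VertexL2) v = c * a v :=
  eq_of_ae_degMeasure hd (Lp.coeFn_smul c a) v

theorem vertexL2_toLp_apply (hd : ∀ v, G.deg v ≠ 0) {a : V → ℂ} (ha : MemLp a 2 G.degMeasure)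
    (v : V) : (ha.toLp a : G.VertexL2) v = a v :=
  eq_of_ae_degMeasure hd ha.coeFn_toLp v

theorem vertexL2_enorm_apply_le (hd : ∀ v, G.deg v ≠ 0) (a : G.VertexL2) (v : V) :
    ‖a v‖ₑ ≤ ‖a‖ₑ := by
  have h1 : ‖a‖ₑ ^ 2 = ∑' v, (G.deg v : ℝ≥0∞) * ‖a v‖ₑ ^ 2 := by
    rw [← lintegral_degMeasure, Lp.enorm_def]
    have h := eLpNorm_nnreal_pow_eq_lintegral (μ := G.degMeasure) (f := a) (p := 2) (by norm_num)
    simpa using h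
  have h2 : ‖a v‖ₑ ^ 2 ≤ ‖a‖ₑ ^ 2 := by
    rw [h1]
    refine le_trans ?_ (ENNReal.le_tsum v)
    refine le_mul_of_one_le_left' ?_
    exact_mod_cast Nat.one_le_iff_ne_zero.2 (hd v)
  exact (ENNReal.pow_le_pow_left_iff two_ne_zero).1 h2

theorem vertexL2_continuous_apply (hd : ∀ v, G.deg v ≠ 0) (v : V) :
    Continuous fun a : G.VertexL2 => a v := by
  let L : G.VertexL2 →ₗ[ℂ] ℂ :=
    { toFun := fun a => a v
      map_add' := fun a b => vertexL2_add_apply hd a b v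
      map_smul' := fun c a => vertexL2_smul_apply hd c a v }
  refine AddMonoidHomClass.continuous_of_bound L 1 fun a => ?_
  have h := ENNReal.toReal_mono enorm_ne_top (vertexL2_enorm_apply_le hd a v)
  simp only [toReal_enorm] at h
  rw [one_mul]
  exact h

theorem vertexL2_memℓp (a : G.VertexL2) :
    Memℓp (fun e => a (G.src e)) 2 ∧ Memℓp (fun e => a (G.tgt e)) 2 :=
  memLp_degMeasure_iff_memℓp.1 (Lp.memLp a)

/-! ### Operators assembled from operators on the edges -/

theorem memℓp_edgeData {ℓ : ℝ} (a : G.VertexL2) (w : EdgeL2 E ℓ) :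
    Memℓp (fun e => ((a (G.src e), a (G.tgt e), w e) : EdgeData ℓ)) 2 :=
  (vertexL2_memℓp a).1.prodMk ((vertexL2_memℓp a).2.prodMk (lp.memℓp w))

theorem exists_assembled (hd : ∀ v, G.deg v ≠ 0) {ℓ : ℝ} (T : EdgeData ℓ →L[ℂ] IntervalL2 ℓ) :
    ∃ P : G.VertexL2 × EdgeL2 E ℓ →L[ℂ] EdgeL2 E ℓ,
      ∀ a w e, P (a, w) e = T (a (G.src e), a (G.tgt e), w e) := by
  let P : G.VertexL2 × EdgeL2 E ℓ →ₗ[ℂ] EdgeL2 E ℓ :=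
    { toFun := fun p => ⟨fun e => T (p.1 (G.src e), p.1 (G.tgt e), p.2 e),
        (memℓp_edgeData p.1 p.2).clm_comp T⟩
      map_add' := fun p q => lp.ext (funext fun e => by
        change T _ = T _ + T _
        rw [← map_add]
        simp only [Prod.fst_add, Prod.snd_add, vertexL2_add_apply hd]
        rfl)
      map_smul' := fun c p => lp.ext (funext fun e => by
        change T _ = c • T _
        rw [← map_smul]
        simp only [Prod.smul_fst, Prod.smul_snd, vertexL2_smul_apply hd]
        rfl) }
  -- Each edge component is continuous, so the graph is closed and boundedness follows without an
  -- estimate.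
  refine ⟨⟨P, P.continuous_of_seq_closed_graph fun u x y hu hy => ?_⟩, fun a w e => rfl⟩
  refine lp.ext (funext fun e => ?_)
  have h1 := ((lp.evalCLM ℂ (fun _ : E => IntervalL2 ℓ) 2 e).continuous.tendsto y).comp hy
  have hc : Continuous fun p : G.VertexL2 × EdgeL2 E ℓ =>
      ((p.1 (G.src e), p.1 (G.tgt e), p.2 e) : EdgeData ℓ) :=
    ((vertexL2_continuous_apply hd _).comp continuous_fst).prodMk
      (((vertexL2_continuous_apply hd _).comp continuous_fst).prodMk
        ((lp.evalCLM ℂ (fun _ : E => IntervalL2 ℓ) 2 e).continuous.comp continuous_snd))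
  exact tendsto_nhds_unique h1 (((T.continuous.comp hc).tendsto x).comp hu)

theorem exists_vertexSource (hd : ∀ v, G.deg v ≠ 0) {ℓ : ℝ} (L M : IntervalL2 ℓ →L[ℂ] ℂ) :
    ∃ B : EdgeL2 E ℓ →L[ℂ] G.VertexL2,
      ∀ w v, B w v = G.vertexAverage (fun e => L (w e)) (fun e => M (w e)) v := by
  have hm := fun w : EdgeL2 E ℓ => memLp_vertexAverage (G := G) ((lp.memℓp w).clm_comp L)
    ((lp.memℓp w).clm_comp M)
  let B : EdgeL2 E ℓ →ₗ[ℂ] G.VertexL2 :=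
    { toFun := fun w => (hm w).toLp _
      map_add' := fun w w' => vertexL2_ext fun v => by
        rw [vertexL2_add_apply hd, vertexL2_toLp_apply hd, vertexL2_toLp_apply hd,
          vertexL2_toLp_apply hd]
        simp only [vertexAverage, lp.coeFn_add, Pi.add_apply, map_add, Finset.sum_add_distrib]
        ring
      map_smul' := fun c w => vertexL2_ext fun v => by
        rw [RingHom.id_apply, vertexL2_smul_apply hd, vertexL2_toLp_apply hd,
          vertexL2_toLp_apply hd]
        simp only [vertexAverage, lp.coeFn_smul, Pi.smul_apply, map_smul, smul_eq_mul,
          ← Finset.mul_sum]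
        ring }
  have hB : ∀ w v, B w v = G.vertexAverage (fun e => L (w e)) (fun e => M (w e)) v :=
    fun w v => vertexL2_toLp_apply hd (hm w) v
  refine ⟨⟨B, B.continuous_of_seq_closed_graph fun u x y hu hy => ?_⟩, hB⟩
  refine vertexL2_ext fun v => ?_
  have h1 := ((vertexL2_continuous_apply hd v).tendsto y).comp hy
  have hc : Continuous fun w : EdgeL2 E ℓ => B w v := by
    simp only [hB, vertexAverage]
    have he : ∀ e, Continuous fun w : EdgeL2 E ℓ => w e := fun e =>
      (lp.evalCLM ℂ (fun _ : E => IntervalL2 ℓ) 2 e).continuous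
    exact continuous_const.mul
      ((continuous_finsetSum _ fun e _ => L.continuous.comp (he e)).add
        (continuous_finsetSum _ fun e _ => M.continuous.comp (he e)))
  exact tendsto_nhds_unique h1 ((hc.tendsto x).comp hu)

/-- Put on each edge a source whose functionals at the start and end are the values of `k` there;
every average is then over copies of `k v`. -/
theorem vertexSource_surjective (hd : ∀ v, G.deg v ≠ 0) {ℓ : ℝ} {L M : IntervalL2 ℓ →L[ℂ] ℂ}
    (hLM : ∀ p q, ∃ u, L u = p ∧ M u = q) {B : EdgeL2 E ℓ →L[ℂ] G.VertexL2}
    (hB : ∀ w v, B w v = G.vertexAverage (fun e => L (w e)) (fun e => M (w e)) v) :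
    Function.Surjective B := by
  intro k
  obtain ⟨u, hu1, hu2⟩ := hLM 1 0
  obtain ⟨u', hu1', hu2'⟩ := hLM 0 1
  let T : EdgeData ℓ →L[ℂ] IntervalL2 ℓ :=
    (ContinuousLinearMap.fst ℂ ℂ (ℂ × IntervalL2 ℓ)).smulRight u +
      ((ContinuousLinearMap.fst ℂ ℂ (IntervalL2 ℓ)).comp
        (ContinuousLinearMap.snd ℂ ℂ (ℂ × IntervalL2 ℓ))).smulRight u'
  obtain ⟨P, hP⟩ := exists_assembled (G := G) hd T
  have hPe : ∀ e, P (k, 0) e = k (G.src e) • u + k (G.tgt e) • u' := fun e => hP k 0 e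
  refine ⟨P (k, 0), vertexL2_ext fun v => ?_⟩
  have h1 : ∑ e ∈ G.outEdges v, k (G.src e) = (G.outEdges v).card * k v := by
    rw [Finset.sum_congr rfl (g := fun _ => k v) (fun e he => by
      rw [show G.src e = v by simpa [outEdges] using he])]
    simp
  have h2 : ∑ e ∈ G.inEdges v, k (G.tgt e) = (G.inEdges v).card * k v := by
    rw [Finset.sum_congr rfl (g := fun _ => k v) (fun e he => by
      rw [show G.tgt e = v by simpa [inEdges] using he])]
    simp
  have hdv : (G.deg v : ℂ) ≠ 0 := by exact_mod_cast hd v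
  rw [hB, vertexAverage]
  simp only [hPe, map_add, map_smul, hu1, hu2, hu1', hu2', smul_eq_mul, mul_one, mul_zero,
    add_zero, zero_add]
  rw [h1, h2, ← add_mul, ← Nat.cast_add, ← deg, inv_mul_cancel_left₀ hdv]

end Graph

variable {V E : Type*} {G : OrientedGraph V E} {ℓ : ℝ} {z : ℂ}

theorem memLp_single [DecidableEq V] (v : V) :
    MemLp (Pi.single v 1 : V → ℂ) 2 G.degMeasure := by
  rw [memLp_degMeasure_iff, tsum_eq_single v fun u hu => by simp [Pi.single_eq_of_ne hu]]
  simp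

/-! ### Sobolev functions with given vertex values -/

variable (G) in
/-- `f` belongs to `H¹(X₀)` with derivative `f'` and vertex values `b`. -/
def HasSobolevTrace (ℓ : ℝ) (f f' : EdgeL2 E ℓ) (b : V → ℂ) : Prop :=
  ∀ e, ∃ F : ℝ → ℂ, f e =ᵐ[volume.restrict (Ioo 0 ℓ)] F ∧ IsPrimitive ℓ F (f' e) ∧
    F 0 = b (G.src e) ∧ F ℓ = b (G.tgt e)

theorem hasSobolevDeriv_iff_exists_trace (hℓ : 0 ≤ ℓ) {f f' : EdgeL2 E ℓ} :
    G.HasSobolevDeriv ℓ f f' ↔ ∃ b, G.HasSobolevTrace ℓ f f' b := by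
  constructor
  · rintro ⟨F, b, h⟩
    exact ⟨b, fun e => ⟨F e, (h e).1,
      ⟨intervalIntegrable_of_intervalL2 (right_mem_Icc.2 hℓ) _, (h e).2.1⟩, (h e).2.2⟩⟩
  · rintro ⟨b, h⟩
    choose F h1 h2 h3 using h
    exact ⟨F, b, fun e => ⟨h1 e, (h2 e).eq_add_integral, h3 e⟩⟩

theorem HasSobolevTrace.sub (hℓ : 0 ≤ ℓ) {f f' g g' : EdgeL2 E ℓ} {a b : V → ℂ}
    (hf : G.HasSobolevTrace ℓ f f' a) (hg : G.HasSobolevTrace ℓ g g' b) :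
    G.HasSobolevTrace ℓ (f - g) (f' - g') (a - b) := by
  intro e
  obtain ⟨F, hF1, hF2, hF3, hF4⟩ := hf e
  obtain ⟨K, hK1, hK2, hK3, hK4⟩ := hg e
  refine ⟨fun x => F x - K x, (Lp.coeFn_sub (f e) (g e)).trans (hF1.sub hK1),
    (hF2.sub hK2).congr_ae (Lp.coeFn_sub (f' e) (g' e)) hℓ, ?_, ?_⟩
  · simp [hF3, hK3]
  · simp [hF4, hK4]

/-- The boundary values of a Sobolev function on an interval are continuous functionals of the
function and its derivative. -/
theorem exists_traceFunctionals (hℓ : 0 < ℓ) :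
    ∃ L M : IntervalL2 ℓ × IntervalL2 ℓ →L[ℂ] ℂ, ∀ (f f' : IntervalL2 ℓ) (F : ℝ → ℂ),
      f =ᵐ[volume.restrict (Ioo 0 ℓ)] F → IsPrimitive ℓ F f' →
        L (f, f') = F 0 ∧ M (f, f') = F ℓ := by
  have hℓ' : (ℓ : ℂ) ≠ 0 := by exact_mod_cast hℓ.ne'
  have key : ∀ c : ℂ, ∃ L : IntervalL2 ℓ × IntervalL2 ℓ →L[ℂ] ℂ,
      ∀ (f f' : IntervalL2 ℓ) (F : ℝ → ℂ),
        f =ᵐ[volume.restrict (Ioo 0 ℓ)] F → IsPrimitive ℓ F f' →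
          L (f, f') = (ℓ - c) * F ℓ + c * F 0 := by
    intro c
    -- Integrating `((x - c) F)'` over the edge isolates `ℓ F 0` for `c = ℓ` and `ℓ F ℓ` for `c =
    -- 0`.
    let k : C(ℝ, ℂ) := ⟨fun x => x - c, by fun_prop⟩
    let k' : C(ℝ, ℂ) := ⟨fun _ => 1, by fun_prop⟩
    refine ⟨(kernelIntegral ℓ k' ℓ).comp (ContinuousLinearMap.fst ℂ _ _) +
      (kernelIntegral ℓ k ℓ).comp (ContinuousLinearMap.snd ℂ _ _), fun f f' F hf hF => ?_⟩
    have hk : IsPrimitive ℓ k k' :=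
      .of_hasDerivAt (fun x => ((hasDerivAt_id (x : ℂ)).sub_const c).comp_ofReal) k'.continuous
    have h := (hk.mul hF hℓ.le).congr_ae (v := fun t => k' t * f t + k t * f' t) (by
      filter_upwards [hf] with x hx
      rw [hx]) hℓ.le
    have h2 := h.integral_eq hℓ.le
    rw [intervalIntegral.integral_add (intervalIntegrable_mul hℓ.le k' f)
      (intervalIntegrable_mul hℓ.le k f')] at h2
    simp only [_root_.add_apply, ContinuousLinearMap.comp_apply, ContinuousLinearMap.coe_fst',
      ContinuousLinearMap.coe_snd', kernelIntegral_apply _ (right_mem_Icc.2 hℓ.le)]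
    rw [h2]
    simp only [k, ContinuousMap.coe_mk]
    push_cast
    ring
  obtain ⟨L, hL⟩ := key ℓ
  obtain ⟨M, hM⟩ := key 0
  refine ⟨(ℓ : ℂ)⁻¹ • L, (ℓ : ℂ)⁻¹ • M, fun f f' F hf hF => ⟨?_, ?_⟩⟩
  · rw [_root_.smul_apply, hL f f' F hf hF, smul_eq_mul]
    field_simp
    ring
  · rw [_root_.smul_apply, hM f f' F hf hF, smul_eq_mul]
    field_simp
    ring

/-- The same two bounded functionals give the end values on all edges, so these inherit square
summability from `f` and `f'`. -/
theorem HasSobolevTrace.memLp (hℓ : 0 < ℓ) {f f' : EdgeL2 E ℓ} {b : V → ℂ}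
    (h : G.HasSobolevTrace ℓ f f' b) : MemLp b 2 G.degMeasure := by
  obtain ⟨L, M, hLM⟩ := exists_traceFunctionals hℓ
  have hp := (lp.memℓp f).prodMk (lp.memℓp f')
  have hb : ∀ e, L (f e, f' e) = b (G.src e) ∧ M (f e, f' e) = b (G.tgt e) := fun e => by
    obtain ⟨F, h1, h2, h3, h4⟩ := h e
    rw [← h3, ← h4]
    exact hLM _ _ F h1 h2
  have h1 := hp.clm_comp L
  have h2 := hp.clm_comp M
  simp only [hb] at h1 h2
  exact memLp_degMeasure_iff_memℓp.2 ⟨h1, h2⟩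

/-- This is where the discrete Laplacian appears: the boundary terms at `v` contain `a(w) - c a(v) =
(a(w) - a(v)) + (1 - c) a(v)` for each neighbour `w`, counted with multiplicity. -/
theorem vertexFlux_eq (hd : ∀ v, G.deg v ≠ 0) (hℓ : 0 ≤ ℓ) (hz : sinSol z ℓ ≠ 0)
    {B : EdgeL2 E ℓ →L[ℂ] G.VertexL2}
    (hB : ∀ w v, B w v = G.vertexAverage (fun e => startFunctional ℓ z (w e))
      (fun e => endFunctional ℓ z (w e)) v)
    (b : V → ℂ) (a : G.VertexL2) (w : EdgeL2 E ℓ) (v : V) :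
    ∑ e ∈ G.outEdges v, -(starRingEnd ℂ (b (G.src e)) *
        edgeSlope ℓ z 0 (a (G.src e), a (G.tgt e), w e)) +
      ∑ e ∈ G.inEdges v, starRingEnd ℂ (b (G.tgt e)) *
        edgeSlope ℓ z ℓ (a (G.src e), a (G.tgt e), w e) =
      starRingEnd ℂ (b v) * (G.deg v / sinSol z ℓ *
        (G.lapFun a v - (1 - cosSol z ℓ) * a v - B w v)) := by
  have hdv : (G.deg v : ℂ) ≠ 0 := by exact_mod_cast hd v
  have e1 : ∑ e ∈ G.outEdges v, -(starRingEnd ℂ (b (G.src e)) *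
        edgeSlope ℓ z 0 (a (G.src e), a (G.tgt e), w e)) =
      -(starRingEnd ℂ (b v) / sinSol z ℓ) * (∑ e ∈ G.outEdges v, (a (G.tgt e) - a v) +
        (1 - cosSol z ℓ) * ((G.outEdges v).card * a v) +
          ∑ e ∈ G.outEdges v, startFunctional ℓ z (w e)) := by
    have : ((G.outEdges v).card * a v : ℂ) = ∑ e ∈ G.outEdges v, a v := by simp
    rw [this, Finset.mul_sum, ← Finset.sum_add_distrib, ← Finset.sum_add_distrib, Finset.mul_sum]
    refine Finset.sum_congr rfl fun e he => ?_
    rw [show G.src e = v by simpa [outEdges] using he, edgeSlope_zero hℓ, initialSlope]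
    field_simp
    ring
  have e2 : ∑ e ∈ G.inEdges v, (starRingEnd ℂ (b (G.tgt e)) *
        edgeSlope ℓ z ℓ (a (G.src e), a (G.tgt e), w e)) =
      -(starRingEnd ℂ (b v) / sinSol z ℓ) * (∑ e ∈ G.inEdges v, (a (G.src e) - a v) +
        (1 - cosSol z ℓ) * ((G.inEdges v).card * a v) +
          ∑ e ∈ G.inEdges v, endFunctional ℓ z (w e)) := by
    have : ((G.inEdges v).card * a v : ℂ) = ∑ e ∈ G.inEdges v, a v := by simp
    rw [this, Finset.mul_sum, ← Finset.sum_add_distrib, ← Finset.sum_add_distrib, Finset.mul_sum]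
    refine Finset.sum_congr rfl fun e he => ?_
    rw [show G.tgt e = v by simpa [inEdges] using he, edgeSlope_right hz]
    field_simp
    ring
  rw [e1, e2, hB, vertexAverage, lapFun]
  have hdeg : (G.deg v : ℂ) = (G.outEdges v).card + (G.inEdges v).card := by
    rw [deg]
    push_cast
    rfl
  generalize ∑ e ∈ G.outEdges v, (a (G.tgt e) - a v) = X1
  generalize ∑ e ∈ G.inEdges v, (a (G.src e) - a v) = X2
  generalize ∑ e ∈ G.outEdges v, startFunctional ℓ z (w e) = X3
  generalize ∑ e ∈ G.inEdges v, endFunctional ℓ z (w e) = X4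
  have hinv : (G.deg v : ℂ) * (G.deg v : ℂ)⁻¹ = 1 := mul_inv_cancel₀ hdv
  rw [div_eq_mul_inv, div_eq_mul_inv]
  linear_combination (starRingEnd ℂ (b v) * (sinSol z ℓ)⁻¹) * (X1 + X2 + X3 + X4) * hinv
    + starRingEnd ℂ (b v) * (sinSol z ℓ)⁻¹ * (1 - cosSol z ℓ) * a v * hdeg

/-! ### Solutions on the metric graph -/

theorem summable_boundaryTerms {b : V → ℂ} (hb : MemLp b 2 G.degMeasure) (a : G.VertexL2)
    (w : EdgeL2 E ℓ) :
    (Summable fun e => starRingEnd ℂ (b (G.src e)) *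
      edgeSlope ℓ z 0 (a (G.src e), a (G.tgt e), w e)) ∧
    Summable fun e => starRingEnd ℂ (b (G.tgt e)) *
      edgeSlope ℓ z ℓ (a (G.src e), a (G.tgt e), w e) := by
  obtain ⟨h1, h2⟩ := memLp_degMeasure_iff_memℓp.1 hb
  have key : ∀ x, Memℓp (fun e => edgeSlope ℓ z x (a (G.src e), a (G.tgt e), w e)) 2 := fun x => by
    obtain ⟨L, hL⟩ := exists_edgeSlope_clm (ℓ := ℓ) (z := z) x
    simpa only [hL] using (memℓp_edgeData a w).clm_comp L
  exact ⟨h1.summable_conj_mul (key 0), h2.summable_conj_mul (key ℓ)⟩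

variable (G) in
/-- `P` and `P'` assign to vertex values `a` and a source `w` the continuous function with vertex
values `a` that solves `-f'' - z f = w` on every edge, and its derivative. -/
structure IsSolutionPair (ℓ : ℝ) (z : ℂ)
    (P P' : G.VertexL2 × EdgeL2 E ℓ →L[ℂ] EdgeL2 E ℓ) : Prop where
  value : ∀ a w e, P (a, w) e =ᵐ[volume.restrict (Ioo 0 ℓ)]
    fun x => edgeValue ℓ z x (a (G.src e), a (G.tgt e), w e)
  slope : ∀ a w e, P' (a, w) e =ᵐ[volume.restrict (Ioo 0 ℓ)]
    fun x => edgeSlope ℓ z x (a (G.src e), a (G.tgt e), w e)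

theorem exists_isSolutionPair (hd : ∀ v, G.deg v ≠ 0) (hℓ : 0 ≤ ℓ) (z : ℂ) :
    ∃ P P', G.IsSolutionPair ℓ z P P' := by
  obtain ⟨T, hT⟩ := exists_edgeSolution (z := z) hℓ
  obtain ⟨T', hT'⟩ := exists_edgeDerivative (z := z) hℓ
  obtain ⟨P, hP⟩ := exists_assembled (G := G) hd T
  obtain ⟨P', hP'⟩ := exists_assembled (G := G) hd T'
  exact ⟨P, P', fun a w e => hP a w e ▸ hT _, fun a w e => hP' a w e ▸ hT' _⟩

namespace IsSolutionPair

variable {P P' : G.VertexL2 × EdgeL2 E ℓ →L[ℂ] EdgeL2 E ℓ}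

theorem hasSobolevTrace (h : G.IsSolutionPair ℓ z P P') (hℓ : 0 ≤ ℓ) (hz : sinSol z ℓ ≠ 0)
    (a : G.VertexL2) (w : EdgeL2 E ℓ) : G.HasSobolevTrace ℓ (P (a, w)) (P' (a, w)) a :=
  fun e => ⟨_, h.value a w e, (isPrimitive_edgeValue hℓ _).congr_ae (h.slope a w e) hℓ,
    edgeValue_zero hℓ _, edgeValue_right hz _⟩

/-- Integration by parts, using that the slope has derivative `-z f - w`. -/
theorem inner_sub_inner_edge (h : G.IsSolutionPair ℓ z P P') (hℓ : 0 ≤ ℓ)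
    {g g' : EdgeL2 E ℓ} {b : V → ℂ} (hg : G.HasSobolevTrace ℓ g g' b)
    (a : G.VertexL2) (w : EdgeL2 E ℓ) (e : E) :
    inner ℂ (g' e) (P' (a, w) e) - inner ℂ (g e) ((w + z • P (a, w)) e) =
      starRingEnd ℂ (b (G.tgt e)) * edgeSlope ℓ z ℓ (a (G.src e), a (G.tgt e), w e) -
        starRingEnd ℂ (b (G.src e)) * edgeSlope ℓ z 0 (a (G.src e), a (G.tgt e), w e) := by
  obtain ⟨F, h1, h2, h3, h4⟩ := hg e
  have hp := h2.conj.mul (isPrimitive_edgeSlope (z := z) hℓ (a (G.src e), a (G.tgt e), w e)) hℓ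
  have hi := hp.integral_eq hℓ
  rw [h3, h4] at hi
  rw [← hi, L2.inner_def, L2.inner_def, ← integral_sub (L2.integrable_inner _ _)
    (L2.integrable_inner _ _), intervalIntegral.integral_of_le hℓ, integral_Ioc_eq_integral_Ioo]
  refine integral_congr_ae ?_
  filter_upwards [h1, h.value a w e, h.slope a w e, Lp.coeFn_add (w e) (z • P (a, w) e),
    Lp.coeFn_smul z (P (a, w) e)] with x hx1 hx2 hx3 hx4 hx5
  have hx6 : (w + z • P (a, w)) e x = w e x + z * P (a, w) e x := by
    refine hx4.trans ?_
    rw [Pi.add_apply, hx5]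
    rfl
  rw [hx6, hx1, hx2, hx3]
  simp only [RCLike.inner_apply]
  ring

theorem tsum_boundaryTerms (h : G.IsSolutionPair ℓ z P P') (hℓ : 0 ≤ ℓ)
    {g g' : EdgeL2 E ℓ} {b : V → ℂ} (hg : G.HasSobolevTrace ℓ g g' b)
    (a : G.VertexL2) (w : EdgeL2 E ℓ) :
    ∑' e, (starRingEnd ℂ (b (G.tgt e)) * edgeSlope ℓ z ℓ (a (G.src e), a (G.tgt e), w e) -
        starRingEnd ℂ (b (G.src e)) * edgeSlope ℓ z 0 (a (G.src e), a (G.tgt e), w e)) =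
      inner ℂ g' (P' (a, w)) - inner ℂ g (w + z • P (a, w)) := by
  have h1 := lp.hasSum_inner (𝕜 := ℂ) g' (P' (a, w))
  have h2 := lp.hasSum_inner (𝕜 := ℂ) g (w + z • P (a, w))
  rw [← (h1.sub h2).tsum_eq]
  exact tsum_congr fun e => (h.inner_sub_inner_edge hℓ hg a w e).symm

/-- Green's formula for a solution on the edges. -/
theorem inner_sub_inner (h : G.IsSolutionPair ℓ z P P') (hd : ∀ v, G.deg v ≠ 0) (hℓ : 0 < ℓ)
    (hz : sinSol z ℓ ≠ 0) {B : EdgeL2 E ℓ →L[ℂ] G.VertexL2}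
    (hB : ∀ w v, B w v = G.vertexAverage (fun e => startFunctional ℓ z (w e))
      (fun e => endFunctional ℓ z (w e)) v)
    {g g' : EdgeL2 E ℓ} {b : V → ℂ} (hg : G.HasSobolevTrace ℓ g g' b)
    (a : G.VertexL2) (w : EdgeL2 E ℓ) :
    inner ℂ g' (P' (a, w)) - inner ℂ g (w + z • P (a, w)) =
      ∑' v, starRingEnd ℂ (b v) * (G.deg v / sinSol z ℓ *
        (G.lapFun a v - (1 - cosSol z ℓ) * a v - B w v)) := by
  obtain ⟨hs0, hs1⟩ := summable_boundaryTerms (z := z) (hg.memLp hℓ) a w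
  rw [← h.tsum_boundaryTerms hℓ.le hg a w, hs1.tsum_sub hs0, sub_eq_neg_add, ← tsum_neg,
    tsum_edges_eq_tsum_vertices hs0.neg hs1]
  refine tsum_congr fun v => ?_
  exact vertexFlux_eq hd hℓ.le hz hB b a w v

/-- A continuous representative that vanishes almost everywhere vanishes up to the ends of the edge,
and every vertex is the end of some edge. -/
theorem eq_zero_of_value_eq_zero (h : G.IsSolutionPair ℓ z P P') (hd : ∀ v, G.deg v ≠ 0)
    (hℓ : 0 < ℓ) (hz : sinSol z ℓ ≠ 0) {a : G.VertexL2} (ha : P (a, 0) = 0) : a = 0 := by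
  have ht := h.hasSobolevTrace hℓ.le hz a 0
  rw [ha] at ht
  obtain ⟨L, M, hLM⟩ := exists_traceFunctionals hℓ
  have hz : ∀ e, a (G.src e) = 0 ∧ a (G.tgt e) = 0 := fun e => by
    obtain ⟨F, h1, h2, h3, h4⟩ := ht e
    have h5 : (0 : ℝ → ℂ) =ᵐ[volume.restrict (Icc 0 ℓ)] F := by
      rw [← restrict_Ioo_eq_restrict_Icc]
      exact (Lp.coeFn_zero _ _ _).symm.trans h1
    have h6 := Measure.eqOn_Icc_of_ae_eq volume hℓ.ne h5 continuousOn_const h2.continuousOn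
    exact ⟨h3.symm.trans (h6 (left_mem_Icc.2 hℓ.le)).symm,
      h4.symm.trans (h6 (right_mem_Icc.2 hℓ.le)).symm⟩
  refine vertexL2_ext fun v => ?_
  rw [eq_of_ae_degMeasure hd (Lp.coeFn_zero _ _ _) v, Pi.zero_apply]
  have hv := hd v
  rw [deg, Ne, Nat.add_eq_zero_iff, Finset.card_eq_zero, Finset.card_eq_zero, not_and_or,
    ← Ne, ← Ne, ← Finset.nonempty_iff_ne_empty, ← Finset.nonempty_iff_ne_empty] at hv
  rcases hv with ⟨e, he⟩ | ⟨e, he⟩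
  · rw [← show G.src e = v by simpa [outEdges] using he]
    exact (hz e).1
  · rw [← show G.tgt e = v by simpa [inEdges] using he]
    exact (hz e).2

/-- A function that vanishes at the vertices and solves `-h'' = z h` weakly on every edge is
zero. -/
theorem eq_zero_of_weak_solution (hd : ∀ v, G.deg v ≠ 0) (hℓ : 0 < ℓ)
    (hz : z ∉ dirichletSpectrum ℓ) {h h' : EdgeL2 E ℓ} (hh : G.HasSobolevTrace ℓ h h' 0)
    (hw : ∀ g g' : EdgeL2 E ℓ, G.HasSobolevTrace ℓ g g' 0 →
      inner ℂ g' h' = z * inner ℂ g h) : h = 0 := by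
  have hz' := sinSol_ne_zero hℓ (conj_notMem_dirichletSpectrum hz)
  obtain ⟨Q, Q', hQ⟩ := exists_isSolutionPair (G := G) hd hℓ.le (starRingEnd ℂ z)
  obtain ⟨B, hB⟩ := exists_vertexSource (G := G) hd (startFunctional ℓ (starRingEnd ℂ z))
    (endFunctional ℓ (starRingEnd ℂ z))
  -- Duality: test with the solution `g` of `-g'' - z̄ g = h` that vanishes at the vertices. Green's
  -- formula for `g` and the weak equation for `h` leave `⟪h, h⟫ = 0`; no regularity of `h'` is
  -- needed.
  have hg := hQ.hasSobolevTrace hℓ.le hz' 0 h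
  have h0 : ((0 : G.VertexL2) : V → ℂ) = 0 :=
    funext fun v => eq_of_ae_degMeasure hd (Lp.coeFn_zero _ _ _) v
  rw [h0] at hg
  have h1 := hw _ _ hg
  have h2 := hQ.inner_sub_inner hd hℓ hz' hB hh 0 h
  simp only [Pi.zero_apply, map_zero, zero_mul, tsum_zero] at h2
  rw [inner_add_right, inner_smul_right] at h2
  have h3 := congrArg (starRingEnd ℂ) h2
  rw [map_sub, map_add, map_mul, inner_conj_symm, inner_conj_symm, inner_conj_symm,
    Complex.conj_conj, h1, map_zero] at h3
  rw [← inner_self_eq_zero (𝕜 := ℂ)]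
  linear_combination -h3

/-- The equation `(Δ_{X₀} - z) f = w` in terms of the discrete Laplacian of the vertex values. -/
theorem mem_laplacianGraph_iff (h : G.IsSolutionPair ℓ z P P') (hd : ∀ v, G.deg v ≠ 0)
    (hℓ : 0 < ℓ) (hz : z ∉ dirichletSpectrum ℓ) {B : EdgeL2 E ℓ →L[ℂ] G.VertexL2}
    (hB : ∀ w v, B w v = G.vertexAverage (fun e => startFunctional ℓ z (w e))
      (fun e => endFunctional ℓ z (w e)) v) (f w : EdgeL2 E ℓ) :
    (f, w + z • f) ∈ G.laplacianGraph ℓ ↔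
      ∃ a : G.VertexL2, P (a, w) = f ∧ ∀ v, G.lapFun a v - spectralMap ℓ z * a v = B w v := by
  have hs := sinSol_ne_zero hℓ hz
  classical
  simp only [spectralMap_eq]
  constructor
  · rintro ⟨f', hf, hweak⟩
    obtain ⟨b, hb⟩ := (hasSobolevDeriv_iff_exists_trace hℓ.le).1 hf
    let a : G.VertexL2 := (hb.memLp hℓ).toLp b
    have hab : ∀ v, a v = b v := vertexL2_toLp_apply hd _
    have hP := h.hasSobolevTrace hℓ.le hs a w
    have hgreen := fun {g g' : EdgeL2 E ℓ} {c : V → ℂ} (hg : G.HasSobolevTrace ℓ g g' c) =>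
      h.inner_sub_inner hd hℓ hs hB hg a w
    have hsub : G.HasSobolevTrace ℓ (f - P (a, w)) (f' - P' (a, w)) 0 := by
      have := hb.sub hℓ.le hP
      rwa [show b - (a : V → ℂ) = 0 from sub_eq_zero.2 (funext fun v => (hab v).symm)] at this
    -- The difference vanishes at the vertices and weakly solves the homogeneous equation on each
    -- edge.
    have hfP : f - P (a, w) = 0 :=
      eq_zero_of_weak_solution hd hℓ hz hsub fun g g' hg => by
        have h1 := hweak g g' ((hasSobolevDeriv_iff_exists_trace hℓ.le).2 ⟨_, hg⟩)
        have h2 := hgreen hg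
        simp only [Pi.zero_apply, map_zero, zero_mul, tsum_zero] at h2
        rw [inner_add_right, inner_smul_right] at h1 h2
        rw [inner_sub_right, inner_sub_right]
        linear_combination h1 - h2
    have hfe : P (a, w) = f := (sub_eq_zero.1 hfP).symm
    refine ⟨a, hfe, fun v => ?_⟩
    -- The test function `P (δ, 0)` has vertex values supported at `v`, so Green's formula isolates
    -- the vertex equation there.
    let δ : G.VertexL2 := (memLp_single (G := G) v).toLp _
    have hδ : ∀ u, δ u = (Pi.single v 1 : V → ℂ) u := vertexL2_toLp_apply hd _
    have hPδ := h.hasSobolevTrace hℓ.le hs δ 0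
    have h1 := hweak _ _ ((hasSobolevDeriv_iff_exists_trace hℓ.le).2 ⟨_, hPδ⟩)
    -- `f = P (a, w)` is known, but not yet that the derivatives agree. Green's formula with the
    -- roles exchanged shows that `f' - P' (a, w)` is orthogonal to `P' (δ, 0)`, which suffices.
    have h2 := h.inner_sub_inner hd hℓ hs hB hsub δ 0
    simp only [Pi.zero_apply, map_zero, zero_mul, tsum_zero, hfP, inner_zero_left, sub_zero] at h2
    have h3 := congrArg (starRingEnd ℂ) h2
    rw [inner_conj_symm, map_zero, inner_sub_right] at h3
    have h4 := hgreen hPδ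
    rw [hfe, ← sub_eq_zero.1 h3, h1, sub_self, tsum_eq_single v fun u hu => by
      rw [hδ, Pi.single_eq_of_ne hu, map_zero, zero_mul], hδ, Pi.single_eq_same, map_one,
      one_mul] at h4
    have hdv : (G.deg v : ℂ) ≠ 0 := by exact_mod_cast hd v
    exact sub_eq_zero.1 ((mul_eq_zero.1 h4.symm).resolve_left (div_ne_zero hdv hs))
  · rintro ⟨a, rfl, ha⟩
    refine ⟨P' (a, w), (hasSobolevDeriv_iff_exists_trace hℓ.le).2
      ⟨_, h.hasSobolevTrace hℓ.le hs a w⟩, fun g g' hg => ?_⟩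
    obtain ⟨b, hb⟩ := (hasSobolevDeriv_iff_exists_trace hℓ.le).1 hg
    rw [← sub_eq_zero, h.inner_sub_inner hd hℓ hs hB hb a w]
    simp [ha]

end IsSolutionPair

/-! ### Comparison of the two Laplacians -/

theorem mem_resolventSet_and_multiplicity {V E : Type*} {G : OrientedGraph V E}
    (hd : ∀ v, G.deg v ≠ 0) {ℓ : ℝ} (hℓ : 0 < ℓ) {z : ℂ} (hz : z ∉ dirichletSpectrum ℓ) :
    (z ∈ OperatorSpectrum.resolventSet (G.metricLaplacian ℓ) ↔
      spectralMap ℓ z ∈ OperatorSpectrum.resolventSet G.discreteLaplacian) ∧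
    OperatorSpectrum.multiplicity (G.metricLaplacian ℓ) z =
      OperatorSpectrum.multiplicity G.discreteLaplacian (spectralMap ℓ z) := by
  have hs := sinSol_ne_zero hℓ hz
  obtain ⟨P, P', h⟩ := exists_isSolutionPair (G := G) hd hℓ.le z
  obtain ⟨B, hB⟩ := exists_vertexSource (G := G) hd (startFunctional ℓ z) (endFunctional ℓ z)
  have hsurj := vertexSource_surjective hd (exists_source hℓ hs) hB
  have hP := fun a => h.eq_zero_of_value_eq_zero hd hℓ hs (a := a)
  -- The discrete Laplacian has full domain; `S` is the same map without the subtype.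
  let S : G.VertexL2 →ₗ[ℂ] G.VertexL2 := G.discreteLaplacian.toFun ∘ₗ
    LinearMap.codRestrict ⊤ LinearMap.id fun _ => trivial
  have hS : G.discreteLaplacian = S.toPMap ⊤ := rfl
  have hSa : ∀ a v, S a v = G.lapFun a v := fun a v =>
    vertexL2_toLp_apply hd (G.memLp_lapFun (Lp.memLp a)) v
  have hchar : ∀ f w, (f, w + z • f) ∈ (G.metricLaplacian ℓ).graph ↔
      ∃ a, P (a, w) = f ∧ S a - spectralMap ℓ z • a = B w := fun f w => by
    rw [metricLaplacian_graph, h.mem_laplacianGraph_iff hd hℓ hz hB]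
    refine exists_congr fun a => and_congr_right fun _ => ?_
    have hv : ∀ v, (S a - spectralMap ℓ z • a : G.VertexL2) v =
        G.lapFun a v - spectralMap ℓ z * a v := fun v => by
      rw [vertexL2_sub_apply hd, vertexL2_smul_apply hd, hSa]
    simp only [← hv]
    exact ⟨vertexL2_ext, fun h v => by rw [h]⟩
  rw [hS]
  exact ⟨OperatorSpectrum.mem_resolventSet_iff_of_solution hsurj hP hchar,
    OperatorSpectrum.multiplicity_eq_of_solution hP hchar⟩

end OrientedGraph

end

theorem mainTheorem11 {V E : Type*} [Countable V] (G : OrientedGraph V E)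
    (hconn : G.Connected) (hloop : ∀ e, G.src e ≠ G.tgt e)
    (d₀ : ℕ) (hdeg : ∀ v, 2 ≤ G.deg v ∧ G.deg v ≤ d₀) (ℓ : ℝ) (hℓ : 0 < ℓ) :
    (∀ k : OperatorSpectrum.SpectrumKind,
      OperatorSpectrum.spectrumOf k (G.metricLaplacian ℓ) \ insert 0 (dirichletSpectrum ℓ) =
        spectralMap ℓ ⁻¹' (OperatorSpectrum.spectrumOf k G.discreteLaplacian \ {0, 2})) ∧
    (∀ k : OperatorSpectrum.SpectrumKind, ∀ z ∉ dirichletSpectrum ℓ,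
      z ∈ OperatorSpectrum.spectrumOf k (G.metricLaplacian ℓ) ↔
        spectralMap ℓ z ∈ OperatorSpectrum.spectrumOf k G.discreteLaplacian) ∧
    (∀ z ∉ dirichletSpectrum ℓ,
      OperatorSpectrum.multiplicity (G.metricLaplacian ℓ) z =
        OperatorSpectrum.multiplicity G.discreteLaplacian (spectralMap ℓ z)) := by
  have hd : ∀ v, G.deg v ≠ 0 := fun v h => by
    have := (hdeg v).1
    omega
  have hmain := fun z (hz : z ∉ dirichletSpectrum ℓ) =>
    OrientedGraph.mem_resolventSet_and_multiplicity hd hℓ hz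
  have hspec : ∀ k : OperatorSpectrum.SpectrumKind, ∀ z ∉ dirichletSpectrum ℓ,
      z ∈ OperatorSpectrum.spectrumOf k (G.metricLaplacian ℓ) ↔
        spectralMap ℓ z ∈ OperatorSpectrum.spectrumOf k G.discreteLaplacian := fun k z hz => by
    have hev := eventually_notMem_dirichletSpectrum hℓ hz
    obtain ⟨hmap, hinj⟩ := spectralMap_locally_bijective hℓ hz
    exact OperatorSpectrum.mem_spectrumOf_iff_of_local hmap hinj
      (hev.mono fun y hy => (hmain y hy).1) (hev.mono fun y hy => (hmain y hy).2) k
  refine ⟨fun k => Set.ext fun z => ?_, hspec, fun z hz => (hmain z hz).2⟩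
  -- The excluded sets on both sides correspond under `g`, so the set equality is the pointwise
  -- statement.
  rw [mem_sdiff, mem_preimage, mem_sdiff, spectralMap_mem_iff hℓ]
  refine and_congr_left fun hz => hspec k z fun h => hz (Or.inr h)
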